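/- For $n=0,1,2,\dots$ let $$G_n=\sum_{k=0}^{n}\left(\frac{1\cdot3\cdots(2k-1)}{2\cdot4\cdots(2k)}\right)^2$$ be the Landau constants (the term with $k=0$ is $1$), let $\gamma$ be Euler's constant, and write $N=n+1$. There are real constants $\alpha_1,\alpha_2,\dots$ with the (Poincaré) asymptotic expansion $$\pi G_n\sim\ln(16N)+\gamma+\sum_{k=1}^{\infty}\frac{\alpha_k}{N^k},\qquad n\to\infty,$$ that is, with $A_l(N)=\ln(16N)+\gamma+\sum_{k=1}^{l}\alpha_kN^{-k}$ one has $\pi G_n-A_l(N)=o(N^{-l})$ for every $l\ge0$. For the coefficients $\alpha_k$ of this expansion, $$A_p(N)<\pi G_n<A_q(N)$$ for all $n=0,1,2,\dots$, all $p\in\{4s+1,4s+2\}$ with $s=0,1,2,\dots$ and all $q\in\{4m,4m+3\}$ with $m=0,1,2,\dots$. For all such $p$ and $q$ these bounds are optimal as $n\to\infty$, in the following sense. First, their errors are of the exact order of the first neglected term: $\alpha_{p+1}>0>\alpha_{q+1}$ and $$\pi G_n-A_p(N)\sim\frac{\alpha_{p+1}}{N^{p+1}},\qquad \pi G_n-A_q(N)\sim\frac{\alpha_{q+1}}{N^{q+1}}\qquad(n\to\infty).$$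 Second, no bound of the same form is better for large $n$: for all real $c_0,c_1,c_2,\dots$, if $B_l(N)=\ln(16N)+\sum_{k=0}^{l}c_kN^{-k}$ satisfies $B_p(N)\le\pi G_n$ for all sufficiently large $n$, then $B_p(N)\le A_p(N)$ for all sufficiently large $n$; and if $\pi G_n\le B_q(N)$ for all sufficiently large $n$, then $A_q(N)\le B_q(N)$ for all sufficiently large $n$. -/

import Mathlib

open Filter Topology Asymptotics

namespace Landau

/-- The Landau constants `G_n = ∑_{k ≤ n} ((1·3⋯(2k-1)) / (2·4⋯(2k)))²`, so `G_0 = 1`. -/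
noncomputable def G (n : ℕ) : ℝ :=
  ∑ k ∈ Finset.range (n + 1),
    (∏ j ∈ Finset.range k, (2 * (j : ℝ) + 1) / (2 * (j : ℝ) + 2)) ^ 2

/-- The truncation `A_l(x) = ln (16 x) + γ + ∑_{k=1}^l α_k / x^k`.
The entry `α 0` is not used. -/
noncomputable def A (α : ℕ → ℝ) (l : ℕ) (x : ℝ) : ℝ :=
  Real.log (16 * x) + Real.eulerMascheroniConstant + ∑ k ∈ Finset.Icc 1 l, α k / x ^ k

/-- `α_1, α_2, …` are the coefficients of the asymptotic expansion (in the sense of Poincaré)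
`π G_n ∼ ln (16 N) + γ + ∑_{k ≥ 1} α_k / N^k`, `N = n + 1`, as `n → ∞`:
for every `l`, the error of the `l`-th truncation is `o(N^{-l})`. -/
def IsExpansion (α : ℕ → ℝ) : Prop :=
  ∀ l : ℕ, (fun n : ℕ => Real.pi * G n - A α l ((n : ℝ) + 1))
    =o[atTop] fun n : ℕ => 1 / ((n : ℝ) + 1) ^ l

/-- The general function of the form `ln (16 x) + c_0 + c_1 / x + ⋯ + c_l / x^l`. -/
noncomputable def trial (c : ℕ → ℝ) (l : ℕ) (x : ℝ) : ℝ :=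
  Real.log (16 * x) + ∑ k ∈ Finset.range (l + 1), c k / x ^ k

end Landau

namespace Landau

open MeasureTheory Set

/-! ### The beta integral on the line and some Fourier transforms -/

/-! The error after `ln (16 N) + γ` is written as a Stieltjes-type integral whose expansion has
remainders of visible sign.

By the beta integral, π times the k-th term of `G n` is the Laplace transform at k + 1/4 of `leg`
(`integral_exp_mul_leg_nat`). Summing in k turns e^{-t/4} into e^{-t/4}/(1 - e^{-t}) = (1/cosh(t/4)
+ 1/sinh(t/4))/4. The error is therefore the Laplace transform of `borel`, up to a constant that
Abel summation identifies from the behaviour of the complete elliptic integral at modulus 1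
(`pi_mul_G_eq`).

`leg` is also a convolution square on the whole line, so it is the Fourier transform of the positive
density `dens`. Averaging a hyperbolic secant and a smoothed step against `dens` gives positive
functions V = `sechAvg` and S = `stepAvg`, whose cosine and sine transforms combine to `borel`.
Hence the error at x is -2 ∫ Re((V + iS)/(x - iy)) dy over y > 0 (`tailInt_eq_integral_borel`).

Expanding 1/(x - iy) as a finite geometric sum gives the coefficients, and the remainder after l
terms is -2 x^{-l} ∫ Re((iy)^l (V + iS)/(x - iy)) dy. Its sign depends on l mod 4. For l ≡ 1, 3 the
integrand consists of two terms of equal sign. For l ≡ 0, 2 it is ± (xV - yS), which for x ≥ 1 is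
settled by the key inequality y S(y) < V(y) (`mul_stepAvg_lt_sechAvg`). That inequality rests on the
monotonicity of `leg`, which bounds `dens` (`abs_mul_dens_mul_cosh_le`), and on a lower bound for V.

Optimality is a comparison of finite polynomials in 1/N: the first nonzero coefficient of the
difference decides its eventual sign. -/

lemma two_cosh_half_pos (v : ℝ) : 0 < 2 * Real.cosh (v / 2) := by
  have := Real.cosh_pos (v / 2)
  positivity

lemma log_sigmoid (v : ℝ) : Real.log (Real.sigmoid v) = v / 2 - Real.log (2 * Real.cosh (v / 2)) := by
  have h : Real.sigmoid v = Real.exp (v / 2) / (2 * Real.cosh (v / 2)) := by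
    rw [Real.sigmoid_def, Real.cosh_eq, inv_eq_one_div, div_eq_div_iff (by positivity) (by positivity)]
    have : Real.exp (-(v / 2)) = Real.exp (v / 2) * Real.exp (-v) := by
      rw [← Real.exp_add]; ring_nf
    rw [this]; ring
  rw [h, Real.log_div (Real.exp_pos _).ne' (two_cosh_half_pos v).ne', Real.log_exp]

lemma log_one_sub_sigmoid (v : ℝ) :
    Real.log (1 - Real.sigmoid v) = -(v / 2) - Real.log (2 * Real.cosh (v / 2)) := by
  rw [← Real.sigmoid_neg, log_sigmoid, neg_div, Real.cosh_neg]

/-- The logistic substitution s = σ(v) has ds = s(1 - s) dv, which cancels the -1 in both exponents.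
The conjugate exponents b ± iτ then leave a pure phase times a power of cosh. -/
lemma beta_integrand_sigmoid (b τ v : ℝ) :
    |Real.sigmoid v * (1 - Real.sigmoid v)| • ((Real.sigmoid v : ℂ) ^ ((b + τ * Complex.I : ℂ) - 1) *
      (1 - (Real.sigmoid v : ℂ)) ^ ((b - τ * Complex.I : ℂ) - 1))
      = Complex.exp (τ * v * Complex.I) * ((2 * Real.cosh (v / 2)) ^ (-(2 * b)) : ℝ) := by
  have h1 := Real.sigmoid_pos v
  have h2 : 0 < 1 - Real.sigmoid v := sub_pos.2 (Real.sigmoid_lt_one v)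
  have h3 : (1 - (Real.sigmoid v : ℂ)) = ((1 - Real.sigmoid v : ℝ) : ℂ) := by push_cast; ring
  rw [abs_of_pos (mul_pos h1 h2), h3, Complex.cpow_def_of_ne_zero (by exact_mod_cast h1.ne'),
    Complex.cpow_def_of_ne_zero (by exact_mod_cast h2.ne'), ← Complex.ofReal_log h1.le,
    ← Complex.ofReal_log h2.le, Complex.real_smul, Real.rpow_def_of_pos (two_cosh_half_pos v)]
  have h4 : (Real.sigmoid v * (1 - Real.sigmoid v) : ℝ)
      = Real.exp (Real.log (Real.sigmoid v) + Real.log (1 - Real.sigmoid v)) := by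
    rw [Real.exp_add, Real.exp_log h1, Real.exp_log h2]
  rw [h4, log_sigmoid, log_one_sub_sigmoid]
  push_cast
  rw [← Complex.exp_add, ← Complex.exp_add, ← Complex.exp_add]
  congr 1
  ring

lemma image_sigmoid : Real.sigmoid '' univ = Ioo 0 1 := by
  rw [image_univ, Real.range_sigmoid]

lemma hasDerivWithinAt_sigmoid (x : ℝ) (_ : x ∈ (univ : Set ℝ)) :
    HasDerivWithinAt Real.sigmoid (Real.sigmoid x * (1 - Real.sigmoid x)) univ x :=
  (Real.hasDerivAt_sigmoid x).hasDerivWithinAt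

/-- The common source of all transforms needed below: b = 1/2 gives sech, b = 1 gives sech², and b =
1/4 gives `kern`. -/
lemma integral_exp_mul_cosh_rpow {b : ℝ} (hb : 0 < b) (τ : ℝ) :
    ∫ v : ℝ, Complex.exp (τ * v * Complex.I) * ((2 * Real.cosh (v / 2)) ^ (-(2 * b)) : ℝ)
      = Complex.Gamma (b + τ * Complex.I) * Complex.Gamma (b - τ * Complex.I)
        / Complex.Gamma (2 * b) := by
  have hu : 0 < (b + τ * Complex.I : ℂ).re := by simpa using hb
  have hv : 0 < (b - τ * Complex.I : ℂ).re := by simpa using hb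
  have h := Complex.betaIntegral_eq_Gamma_mul_div _ _ hu hv
  rw [show (b + τ * Complex.I : ℂ) + (b - τ * Complex.I) = 2 * b by ring] at h
  rw [← h, Complex.betaIntegral, intervalIntegral.integral_of_le zero_le_one,
    integral_Ioc_eq_integral_Ioo, ← image_sigmoid,
    integral_image_eq_integral_abs_deriv_smul MeasurableSet.univ hasDerivWithinAt_sigmoid
      Real.sigmoid_injective.injOn]
  simp only [beta_integrand_sigmoid, Measure.restrict_univ]

lemma integrable_cosh_rpow {b : ℝ} (hb : 0 < b) :
    Integrable fun v : ℝ => (2 * Real.cosh (v / 2)) ^ (-(2 * b)) := by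
  have hu : 0 < (b + (0 : ℝ) * Complex.I : ℂ).re := by simpa using hb
  have hv : 0 < (b - (0 : ℝ) * Complex.I : ℂ).re := by simpa using hb
  have h := Complex.betaIntegral_convergent hu hv
  rw [intervalIntegrable_iff_integrableOn_Ioo_of_le zero_le_one, ← image_sigmoid,
    integrableOn_image_iff_integrableOn_abs_deriv_smul MeasurableSet.univ hasDerivWithinAt_sigmoid
      Real.sigmoid_injective.injOn] at h
  simp only [beta_integrand_sigmoid, integrableOn_univ] at h
  have h2 := h.re
  simpa using h2

lemma cosh_rpow_neg_one (v : ℝ) :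
    (2 * Real.cosh (v / 2)) ^ (-(2 * (1 / 2 : ℝ))) = 1 / (2 * Real.cosh (v / 2)) := by
  norm_num [Real.rpow_neg_one]

lemma cosh_rpow_neg_two (v : ℝ) :
    (2 * Real.cosh (v / 2)) ^ (-(2 * (1 : ℝ))) = 1 / (2 * Real.cosh (v / 2)) ^ 2 := by
  rw [mul_one, Real.rpow_neg (two_cosh_half_pos v).le, Real.rpow_two, one_div]

lemma integrable_sech : Integrable fun v : ℝ => 1 / (2 * Real.cosh (v / 2)) := by
  simpa only [cosh_rpow_neg_one] using integrable_cosh_rpow (b := 1 / 2) (by norm_num)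

lemma integrable_sech_sq : Integrable fun v : ℝ => 1 / (2 * Real.cosh (v / 2)) ^ 2 := by
  simpa only [cosh_rpow_neg_two] using integrable_cosh_rpow (b := 1) (by norm_num)

lemma integral_exp_mul_sech (τ : ℝ) :
    ∫ v : ℝ, Complex.exp (τ * v * Complex.I) * ((1 / (2 * Real.cosh (v / 2)) : ℝ) : ℂ)
      = ((Real.pi / Real.cosh (Real.pi * τ) : ℝ) : ℂ) := by
  have h := integral_exp_mul_cosh_rpow (b := 1 / 2) (by norm_num) τ
  simp only [cosh_rpow_neg_one] at h
  rw [h, show (2 * ((1 / 2 : ℝ) : ℂ)) = 1 by push_cast; ring, Complex.Gamma_one, div_one]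
  have h2 := Complex.Gamma_mul_Gamma_one_sub (((1 / 2 : ℝ) : ℂ) + τ * Complex.I)
  rw [show (1 : ℂ) - (((1 / 2 : ℝ) : ℂ) + τ * Complex.I) = ((1 / 2 : ℝ) : ℂ) - τ * Complex.I by
    push_cast; ring] at h2
  rw [h2, show (Real.pi : ℂ) * (((1 / 2 : ℝ) : ℂ) + τ * Complex.I)
    = ((Real.pi * τ : ℝ) : ℂ) * Complex.I + Real.pi / 2 by push_cast; ring,
    Complex.sin_add_pi_div_two, Complex.cos_mul_I]
  push_cast
  rfl

lemma integral_exp_mul_sech_sq (τ : ℝ) (hτ : τ ≠ 0) :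
    ∫ v : ℝ, Complex.exp (τ * v * Complex.I) * ((1 / (2 * Real.cosh (v / 2)) ^ 2 : ℝ) : ℂ)
      = ((Real.pi * τ / Real.sinh (Real.pi * τ) : ℝ) : ℂ) := by
  have h := integral_exp_mul_cosh_rpow (b := 1) (by norm_num) τ
  simp only [cosh_rpow_neg_two] at h
  rw [h, show (2 * ((1 : ℝ) : ℂ)) = ((1 : ℕ) : ℂ) + 1 by push_cast; ring, Complex.Gamma_nat_eq_factorial]
  have h0 : (τ * Complex.I : ℂ) ≠ 0 := by simp [hτ]
  have h1 := Complex.Gamma_add_one _ h0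
  have h2 := Complex.Gamma_mul_Gamma_one_sub (τ * Complex.I)
  rw [Complex.ofReal_one, add_comm, h1, mul_assoc, h2]
  rw [← mul_assoc (Real.pi : ℂ), ← Complex.ofReal_mul, Complex.sin_mul_I]
  push_cast
  have h3 : Complex.sinh (Real.pi * τ) ≠ 0 := by
    rw [← Complex.ofReal_mul, ← Complex.ofReal_sinh]
    exact_mod_cast Real.sinh_ne_zero.2 (by positivity)
  simp only [Nat.factorial_one, Nat.cast_one, div_one]
  field_simp

lemma integrable_sech_scaled {c : ℝ} (hc : c ≠ 0) :
    Integrable fun y : ℝ => 1 / (2 * Real.cosh (c * y)) := by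
  have h := integrable_sech.comp_mul_left' (R := 2 * c) (by positivity)
  refine h.congr (Eventually.of_forall fun y => ?_)
  simp only
  congr 3; ring

lemma integrable_sech_sq_scaled {c : ℝ} (hc : c ≠ 0) :
    Integrable fun y : ℝ => 1 / (2 * Real.cosh (c * y)) ^ 2 := by
  have h := integrable_sech_sq.comp_mul_left' (R := 2 * c) (by positivity)
  refine h.congr (Eventually.of_forall fun y => ?_)
  simp only
  congr 4; ring

lemma integral_exp_mul_sech_scaled {c : ℝ} (hc : 0 < c) (t : ℝ) :
    ∫ y : ℝ, Complex.exp (t * y * Complex.I) * ((1 / (2 * Real.cosh (c * y)) : ℝ) : ℂ)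
      = ((Real.pi / (2 * c) / Real.cosh (Real.pi * t / (2 * c)) : ℝ) : ℂ) := by
  have h := Measure.integral_comp_mul_left (fun v : ℝ => Complex.exp ((t / (2 * c) : ℝ) * v * Complex.I) *
    ((1 / (2 * Real.cosh (v / 2)) : ℝ) : ℂ)) (2 * c)
  rw [integral_exp_mul_sech, abs_of_pos (by positivity)] at h
  have e : ∀ y : ℝ, Complex.exp ((t / (2 * c) : ℝ) * (2 * c * y : ℝ) * Complex.I) *
      ((1 / (2 * Real.cosh ((2 * c * y) / 2)) : ℝ) : ℂ)
      = Complex.exp (t * y * Complex.I) * ((1 / (2 * Real.cosh (c * y)) : ℝ) : ℂ) := by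
    intro y
    have hc' : (c : ℂ) ≠ 0 := by exact_mod_cast hc.ne'
    congr 1
    · congr 1; push_cast; field_simp
    · congr 4; ring
  simp only [e] at h
  rw [h, Complex.real_smul, ← Complex.ofReal_mul]
  congr 1
  rw [mul_div_assoc]
  field_simp

lemma integral_exp_mul_sech_sq_scaled {c t : ℝ} (hc : 0 < c) (ht : t ≠ 0) :
    ∫ y : ℝ, Complex.exp (t * y * Complex.I) * ((1 / (2 * Real.cosh (c * y)) ^ 2 : ℝ) : ℂ)
      = ((Real.pi * t / (2 * c) ^ 2 / Real.sinh (Real.pi * t / (2 * c)) : ℝ) : ℂ) := by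
  have h := Measure.integral_comp_mul_left (fun v : ℝ => Complex.exp ((t / (2 * c) : ℝ) * v * Complex.I) *
    ((1 / (2 * Real.cosh (v / 2)) ^ 2 : ℝ) : ℂ)) (2 * c)
  rw [integral_exp_mul_sech_sq _ (by positivity), abs_of_pos (by positivity)] at h
  have e : ∀ y : ℝ, Complex.exp ((t / (2 * c) : ℝ) * (2 * c * y : ℝ) * Complex.I) *
      ((1 / (2 * Real.cosh ((2 * c * y) / 2)) ^ 2 : ℝ) : ℂ)
      = Complex.exp (t * y * Complex.I) * ((1 / (2 * Real.cosh (c * y)) ^ 2 : ℝ) : ℂ) := by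
    intro y
    have hc' : (c : ℂ) ≠ 0 := by exact_mod_cast hc.ne'
    congr 1
    · congr 1; push_cast; field_simp
    · congr 5; ring
  simp only [e] at h
  rw [h, Complex.real_smul, ← Complex.ofReal_mul]
  congr 1
  rw [mul_div_assoc]
  field_simp

lemma integral_sech_scaled {c : ℝ} (hc : 0 < c) :
    ∫ y : ℝ, 1 / (2 * Real.cosh (c * y)) = Real.pi / (2 * c) := by
  have h := integral_exp_mul_sech_scaled hc 0
  simp only [Complex.ofReal_zero, zero_mul, Complex.exp_zero, one_mul, integral_complex_ofReal,
    mul_zero, zero_div, Real.cosh_zero, div_one] at h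
  exact_mod_cast h


/-! ### The Legendre function `P_{-1/2}(cosh (t / 2))` -/

/-- The kernel `(2 cosh (x / 2))^{-1/2}`. -/
noncomputable def kern (x : ℝ) : ℝ := 1 / √(2 * Real.cosh (x / 2))

/-- The function `P_{-1/2}(cosh (t / 2))`, as a convolution square. -/
noncomputable def leg (t : ℝ) : ℝ := 1 / Real.pi * ∫ x, kern x * kern (t - x)

/-- The kernel `(2 sinh (x / 2))^{-1/2}`. -/
noncomputable def halfKern (x : ℝ) : ℝ := 1 / √(2 * Real.sinh (x / 2))

lemma kern_eq_rpow (x : ℝ) : kern x = (2 * Real.cosh (x / 2)) ^ (-(2 * (1 / 4 : ℝ))) := by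
  rw [kern, Real.sqrt_eq_rpow, Real.rpow_neg (two_cosh_half_pos x).le, one_div]
  norm_num

lemma kern_pos (x : ℝ) : 0 < kern x :=
  one_div_pos.2 (Real.sqrt_pos.2 (two_cosh_half_pos x))

lemma kern_le_one (x : ℝ) : kern x ≤ 1 := by
  rw [kern]
  have : 1 ≤ √(2 * Real.cosh (x / 2)) := by
    rw [Real.one_le_sqrt]; linarith [Real.one_le_cosh (x / 2)]
  exact (div_le_one (by positivity)).2 this

lemma continuous_kern : Continuous kern := by
  unfold kern
  refine continuous_const.div (by fun_prop) fun x => (Real.sqrt_pos.2 (two_cosh_half_pos x)).ne'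

lemma integrable_kern : Integrable kern := by
  simpa only [← kern_eq_rpow] using integrable_cosh_rpow (b := 1 / 4) (by norm_num)

lemma integrable_kern_mul (t : ℝ) : Integrable fun x => kern x * kern (t - x) := by
  refine integrable_kern.mul_bdd (c := 1) (continuous_kern.comp (by fun_prop)).aestronglyMeasurable ?_
  filter_upwards with x
  rw [Real.norm_of_nonneg (kern_pos _).le]
  exact kern_le_one _

/-- With the convolution variable centred at t/2, cosh(a + b) cosh(a - b) = cosh² a + sinh² b
separates t from x, so monotonicity in t and lower bounds can be read off pointwise. -/
lemma kern_mul_kern (t x : ℝ) : kern (x + t / 2) * kern (t - (x + t / 2))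
    = 1 / (2 * √(Real.cosh (t / 4) ^ 2 + Real.sinh (x / 2) ^ 2)) := by
  rw [kern, kern, div_mul_div_comm, ← Real.sqrt_mul (two_cosh_half_pos _).le, one_mul]
  congr 1
  rw [show (2 : ℝ) = √4 by rw [show (4 : ℝ) = 2 ^ 2 by norm_num]; simp, ← Real.sqrt_mul (by norm_num)]
  rw [show √4 = (2 : ℝ) by rw [show (4 : ℝ) = 2 ^ 2 by norm_num]; simp]
  congr 1
  rw [show (x + t / 2) / 2 = t / 4 + x / 2 by ring, show (t - (x + t / 2)) / 2 = t / 4 - x / 2 by ring,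
    Real.cosh_add, Real.cosh_sub]
  have h1 := Real.cosh_sq (x / 2)
  have h2 := Real.cosh_sq (t / 4)
  linear_combination 4 * Real.cosh (t / 4) ^ 2 * h1 + 4 * Real.sinh (x / 2) ^ 2 * h2

lemma leg_eq (t : ℝ) : leg t
    = 1 / Real.pi * ∫ x, 1 / (2 * √(Real.cosh (t / 4) ^ 2 + Real.sinh (x / 2) ^ 2)) := by
  rw [leg, ← integral_add_right_eq_self _ (t / 2)]
  simp only [kern_mul_kern]

lemma integrable_leg_integrand (t : ℝ) :
    Integrable fun x => 1 / (2 * √(Real.cosh (t / 4) ^ 2 + Real.sinh (x / 2) ^ 2)) := by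
  simpa only [kern_mul_kern] using (integrable_kern_mul t).comp_add_right (t / 2)

lemma leg_nonneg (t : ℝ) : 0 ≤ leg t := by
  rw [leg_eq]
  have := Real.pi_pos
  exact mul_nonneg (by positivity) (integral_nonneg fun x => by positivity)

lemma leg_antitoneOn : AntitoneOn leg (Ici 0) := by
  intro s hs t _ hst
  rw [leg_eq, leg_eq]
  have := Real.pi_pos
  refine mul_le_mul_of_nonneg_left (integral_mono (integrable_leg_integrand t)
    (integrable_leg_integrand s) fun x => ?_) (by positivity)
  simp only [mem_Ici] at hs
  have h1 : Real.cosh (s / 4) ≤ Real.cosh (t / 4) := by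
    rw [Real.cosh_le_cosh, abs_of_nonneg (by positivity), abs_of_nonneg (by linarith)]
    linarith
  have h2 := Real.cosh_pos (s / 4)
  have h3 : 0 < Real.cosh (s / 4) ^ 2 + Real.sinh (x / 2) ^ 2 := by positivity
  have := Real.sqrt_pos.2 h3
  dsimp only
  gcongr

lemma leg_zero : leg 0 = 1 := by
  rw [leg_eq]
  have h : ∀ x : ℝ, 1 / (2 * √(Real.cosh (0 / 4) ^ 2 + Real.sinh (x / 2) ^ 2))
      = 1 / (2 * Real.cosh (1 / 2 * x)) := by
    intro x
    rw [zero_div, Real.cosh_zero, one_pow, add_comm, ← Real.cosh_sq, Real.sqrt_sq (Real.cosh_pos _).le]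
    congr 3; ring
  simp only [h]
  rw [integral_sech_scaled (by norm_num)]
  have := Real.pi_pos
  field_simp

/-- Pointwise, cosh² a + sinh² b ≤ cosh² a cosh² b because cosh a ≥ 1; what remains is the integral
of sech. -/
lemma one_div_cosh_le_leg (t : ℝ) : 1 / Real.cosh (t / 4) ≤ leg t := by
  have hp := Real.pi_pos
  have hc := Real.cosh_pos (t / 4)
  have h1 : 1 / Real.cosh (t / 4)
      = 1 / Real.pi * ∫ x, 1 / Real.cosh (t / 4) * (1 / (2 * Real.cosh (1 / 2 * x))) := by
    rw [integral_const_mul, integral_sech_scaled (by norm_num)]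
    field_simp
  rw [leg_eq, h1]
  refine mul_le_mul_of_nonneg_left (integral_mono ((integrable_sech_scaled (by norm_num)).const_mul _)
    (integrable_leg_integrand t) fun x => ?_) (by positivity)
  have hx := Real.cosh_pos (1 / 2 * x)
  have h3 : 0 < Real.cosh (t / 4) ^ 2 + Real.sinh (x / 2) ^ 2 := by positivity
  have h4 : √(Real.cosh (t / 4) ^ 2 + Real.sinh (x / 2) ^ 2)
      ≤ Real.cosh (t / 4) * Real.cosh (1 / 2 * x) := by
    rw [Real.sqrt_le_left (by positivity), mul_pow, Real.cosh_sq (1 / 2 * x),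
      show 1 / 2 * x = x / 2 by ring]
    have : 1 ≤ Real.cosh (t / 4) ^ 2 := one_le_pow₀ (Real.one_le_cosh _)
    nlinarith [sq_nonneg (Real.sinh (x / 2))]
  dsimp only
  rw [div_mul_div_comm, one_mul]
  refine one_div_le_one_div_of_le (by positivity) ?_
  linarith

/-- The substitution used to pass from the line to the interval `(0, t)`. -/
noncomputable def moebius (t z : ℝ) : ℝ :=
  t + Real.log (1 + Real.exp z) - Real.log (Real.exp t + Real.exp z)

lemma hasDerivAt_moebius (t z : ℝ) : HasDerivAt (moebius t)
    (Real.exp z * (Real.exp t - 1) / ((1 + Real.exp z) * (Real.exp t + Real.exp z))) z := by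
  have h1 : HasDerivAt (fun z => Real.log (1 + Real.exp z)) (Real.exp z / (1 + Real.exp z)) z :=
    ((Real.hasDerivAt_exp z).const_add 1).log (by positivity)
  have h2 : HasDerivAt (fun z => Real.log (Real.exp t + Real.exp z))
      (Real.exp z / (Real.exp t + Real.exp z)) z :=
    ((Real.hasDerivAt_exp z).const_add _).log (by positivity)
  convert! (h1.const_add t).sub h2 using 1
  field_simp
  ring

lemma exp_moebius (t z : ℝ) : Real.exp (moebius t z)
    = Real.exp t * (1 + Real.exp z) / (Real.exp t + Real.exp z) := by
  rw [moebius, Real.exp_sub, Real.exp_add, Real.exp_log (by positivity), Real.exp_log (by positivity)]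

lemma moebius_strictMono {t : ℝ} (ht : 0 < t) : StrictMono (moebius t) := by
  refine strictMono_of_deriv_pos fun z => ?_
  rw [(hasDerivAt_moebius t z).deriv]
  have := Real.one_lt_exp_iff.2 ht
  have := sub_pos.2 this
  positivity

lemma moebius_mem {t : ℝ} (ht : 0 < t) (z : ℝ) : moebius t z ∈ Ioo 0 t := by
  have h1 := Real.one_lt_exp_iff.2 ht
  have hz := Real.exp_pos z
  constructor
  · rw [← Real.exp_lt_exp, exp_moebius, Real.exp_zero, lt_div_iff₀ (by positivity)]
    nlinarith
  · rw [← Real.exp_lt_exp, exp_moebius, div_lt_iff₀ (by positivity)]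
    nlinarith [Real.exp_pos t]

lemma image_moebius {t : ℝ} (ht : 0 < t) : moebius t '' univ = Ioo 0 t := by
  rw [image_univ]
  refine Subset.antisymm (range_subset_iff.2 (moebius_mem ht)) fun x hx => ?_
  have h1 : 1 < Real.exp x := Real.one_lt_exp_iff.2 hx.1
  have h2 : Real.exp x < Real.exp t := Real.exp_lt_exp.2 hx.2
  have h3 : 0 < Real.exp t * (Real.exp x - 1) / (Real.exp t - Real.exp x) :=
    div_pos (mul_pos (Real.exp_pos _) (by linarith)) (by linarith)
  -- The formula of `exp_moebius` solved for e^z.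
  refine ⟨Real.log (Real.exp t * (Real.exp x - 1) / (Real.exp t - Real.exp x)), ?_⟩
  rw [← Real.exp_eq_exp, exp_moebius, Real.exp_log h3]
  have h4 : Real.exp t - Real.exp x ≠ 0 := by linarith
  have h5 : Real.exp t - 1 ≠ 0 := by linarith
  have h6 : Real.exp t ≠ 0 := (Real.exp_pos t).ne'
  rw [div_eq_iff]
  · field_simp
    ring
  · have := Real.exp_pos t
    positivity

/-- In the variables e^z and e^x the substitution is a fractional linear map of (0, ∞) onto (1,
e^t). The product of the sinh factors equals the squared derivative times the product of the cosh
factors, so the Jacobian is exactly absorbed by the square roots. -/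
lemma moebius_kern {t : ℝ} (ht : 0 < t) (z : ℝ) :
    |Real.exp z * (Real.exp t - 1) / ((1 + Real.exp z) * (Real.exp t + Real.exp z))| •
      (halfKern (moebius t z) * halfKern (t - moebius t z)) = kern z * kern (t - z) := by
  have hm := moebius_mem ht z
  have h1 := sub_pos.2 (Real.one_lt_exp_iff.2 ht)
  have e1 : ∀ x : ℝ, 2 * Real.sinh (x / 2) = (Real.exp x - 1) / Real.exp (x / 2) := by
    intro x
    rw [Real.sinh_eq, Real.exp_neg, eq_div_iff (Real.exp_pos _).ne']
    have : Real.exp x = Real.exp (x / 2) * Real.exp (x / 2) := by rw [← Real.exp_add]; ring_nf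
    rw [this]; field_simp
  have e2 : ∀ x : ℝ, 2 * Real.cosh (x / 2) = (Real.exp x + 1) / Real.exp (x / 2) := by
    intro x
    rw [Real.cosh_eq, Real.exp_neg, eq_div_iff (Real.exp_pos _).ne']
    have : Real.exp x = Real.exp (x / 2) * Real.exp (x / 2) := by rw [← Real.exp_add]; ring_nf
    rw [this]; field_simp
  have s1 : 0 < 2 * Real.sinh (moebius t z / 2) := by
    have := Real.sinh_pos_iff.2 (half_pos hm.1); positivity
  have s2 : 0 < 2 * Real.sinh ((t - moebius t z) / 2) := by
    have := Real.sinh_pos_iff.2 (half_pos (sub_pos.2 hm.2)); positivity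
  have p1 : 2 * Real.sinh (moebius t z / 2) * (2 * Real.sinh ((t - moebius t z) / 2))
      = Real.exp z * (Real.exp t - 1) ^ 2 /
        ((Real.exp t + Real.exp z) * (1 + Real.exp z) * Real.exp (t / 2)) := by
    rw [e1, e1, div_mul_div_comm, ← Real.exp_add, ← add_div, add_sub_cancel, Real.exp_sub,
      exp_moebius]
    have := Real.exp_pos t
    have := Real.exp_pos z
    field_simp
    ring
  have p2 : 2 * Real.cosh (z / 2) * (2 * Real.cosh ((t - z) / 2))
      = (1 + Real.exp z) * (Real.exp t + Real.exp z) / (Real.exp z * Real.exp (t / 2)) := by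
    rw [e2, e2, div_mul_div_comm, ← Real.exp_add, ← add_div, add_sub_cancel, Real.exp_sub]
    field_simp
    ring
  rw [halfKern, halfKern, kern, kern, div_mul_div_comm, div_mul_div_comm, ← Real.sqrt_mul s1.le,
    ← Real.sqrt_mul (two_cosh_half_pos z).le, p1, p2, smul_eq_mul]
  have q : Real.exp z * (Real.exp t - 1) ^ 2 /
        ((Real.exp t + Real.exp z) * (1 + Real.exp z) * Real.exp (t / 2))
      = (Real.exp z * (Real.exp t - 1) / ((1 + Real.exp z) * (Real.exp t + Real.exp z))) ^ 2 *
        ((1 + Real.exp z) * (Real.exp t + Real.exp z) / (Real.exp z * Real.exp (t / 2))) := by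
    field_simp
  have hpos : 0 < Real.exp z * (Real.exp t - 1) / ((1 + Real.exp z) * (Real.exp t + Real.exp z)) := by
    positivity
  rw [q, Real.sqrt_mul (by positivity), Real.sqrt_sq hpos.le, abs_of_pos hpos]
  have : 0 < √((1 + Real.exp z) * (Real.exp t + Real.exp z) / (Real.exp z * Real.exp (t / 2))) := by
    positivity
  field_simp

/-- This second form of `leg`, a one-sided convolution, is the one adapted to the Laplace transform;
the two-sided form is adapted to the Fourier transform. -/
lemma integral_halfKern_mul {t : ℝ} (ht : 0 < t) :
    ∫ x in (0 : ℝ)..t, halfKern x * halfKern (t - x) = Real.pi * leg t := by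
  rw [intervalIntegral.integral_of_le ht.le, integral_Ioc_eq_integral_Ioo, ← image_moebius ht,
    integral_image_eq_integral_abs_deriv_smul MeasurableSet.univ
      (fun z _ => (hasDerivAt_moebius t z).hasDerivWithinAt) (moebius_strictMono ht).injective.injOn]
  simp only [moebius_kern ht, Measure.restrict_univ]
  rw [leg]
  field_simp

/-! ### Laplace transform of `leg` -/

lemma image_exp_neg : (fun x : ℝ => Real.exp (-x)) '' Ioi 0 = Ioo 0 1 := by
  ext y
  constructor
  · rintro ⟨x, hx, rfl⟩
    exact ⟨Real.exp_pos _, Real.exp_lt_one_iff.2 (neg_lt_zero.2 hx)⟩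
  · rintro ⟨h0, h1⟩
    exact ⟨-Real.log y, neg_pos.2 (Real.log_neg h0 h1), by simp [Real.exp_log h0]⟩

lemma halfKern_substitution (w : ℂ) {x : ℝ} (hx : x ∈ Ioi (0 : ℝ)) :
    |(-Real.exp (-x))| • (((Real.exp (-x) : ℝ) : ℂ) ^ ((w + 1 / 4) - 1) *
      (1 - ((Real.exp (-x) : ℝ) : ℂ)) ^ ((1 / 2 : ℂ) - 1)) = Complex.exp (-w * x) * halfKern x := by
  have hx' : 0 < x := hx
  have h1 : 0 < 1 - Real.exp (-x) := sub_pos.2 (Real.exp_lt_one_iff.2 (neg_lt_zero.2 hx))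
  have s1 : 0 < 2 * Real.sinh (x / 2) := by
    have := Real.sinh_pos_iff.2 (half_pos hx'); positivity
  have h2 : halfKern x = Real.exp (-(x / 4)) * (1 - Real.exp (-x)) ^ (-(1 / 2) : ℝ) := by
    have e : 2 * Real.sinh (x / 2) = Real.exp (x / 2) * (1 - Real.exp (-x)) := by
      rw [Real.sinh_eq, mul_sub, ← Real.exp_add]; ring_nf
    rw [halfKern, e, Real.sqrt_eq_rpow, Real.mul_rpow (Real.exp_pos _).le h1.le, ← Real.exp_mul,
      Real.rpow_neg h1.le, Real.exp_neg (x / 4), one_div, mul_inv, show x / 2 * (1 / 2) = x / 4 by ring]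
  have h3 : (1 - ((Real.exp (-x) : ℝ) : ℂ)) ^ ((1 / 2 : ℂ) - 1)
      = (((1 - Real.exp (-x)) ^ (-(1 / 2) : ℝ) : ℝ) : ℂ) := by
    rw [Complex.ofReal_cpow h1.le]
    push_cast
    norm_num
  rw [h2, h3, abs_neg, abs_of_pos (Real.exp_pos _), Complex.real_smul,
    Complex.cpow_def_of_ne_zero (by exact_mod_cast (Real.exp_pos _).ne'),
    ← Complex.ofReal_log (Real.exp_pos _).le, Real.log_exp]
  push_cast
  rw [← mul_assoc, ← mul_assoc, ← Complex.exp_add, ← Complex.exp_add]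
  congr 2
  ring

lemma hasDerivWithinAt_exp_neg (x : ℝ) (_ : x ∈ Ioi (0 : ℝ)) :
    HasDerivWithinAt (fun x : ℝ => Real.exp (-x)) (-Real.exp (-x)) (Ioi 0) x := by
  have := (Real.hasDerivAt_exp (-x)).comp x (hasDerivAt_neg x)
  simp only [mul_neg, mul_one] at this
  exact this.hasDerivWithinAt

lemma exp_neg_injOn : InjOn (fun x : ℝ => Real.exp (-x)) (Ioi 0) :=
  fun _ _ _ _ h => neg_injective (Real.exp_injective h)

lemma integral_exp_mul_halfKern (w : ℂ) :
    ∫ x in Ioi (0 : ℝ), Complex.exp (-w * x) * halfKern x = Complex.betaIntegral (w + 1 / 4) (1 / 2) := by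
  rw [Complex.betaIntegral, intervalIntegral.integral_of_le zero_le_one,
    integral_Ioc_eq_integral_Ioo, ← image_exp_neg,
    integral_image_eq_integral_abs_deriv_smul measurableSet_Ioi hasDerivWithinAt_exp_neg exp_neg_injOn]
  exact setIntegral_congr_fun measurableSet_Ioi fun x hx => (halfKern_substitution w hx).symm

lemma integrableOn_exp_mul_halfKern {w : ℂ} (hw : -(1 / 4) < w.re) :
    IntegrableOn (fun x : ℝ => Complex.exp (-w * x) * halfKern x) (Ioi 0) := by
  have hu : 0 < (w + 1 / 4 : ℂ).re := by
    simp only [Complex.add_re]; norm_num; linarith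
  have h := Complex.betaIntegral_convergent hu (v := 1 / 2) (by norm_num)
  rw [intervalIntegrable_iff_integrableOn_Ioo_of_le zero_le_one, ← image_exp_neg,
    integrableOn_image_iff_integrableOn_abs_deriv_smul measurableSet_Ioi hasDerivWithinAt_exp_neg
      exp_neg_injOn] at h
  exact h.congr_fun (fun x hx => halfKern_substitution w hx) measurableSet_Ioi

lemma exp_mul_leg_eq_posConvolution (w : ℂ) {t : ℝ} (ht : t ∈ Ioi (0 : ℝ)) :
    posConvolution (fun x : ℝ => Complex.exp (-w * x) * halfKern x)
      (fun x : ℝ => Complex.exp (-w * x) * halfKern x) (ContinuousLinearMap.mul ℝ ℂ) volume t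
      = Real.pi * (Complex.exp (-w * t) * leg t) := by
  rw [posConvolution, indicator_of_mem ht]
  simp only [ContinuousLinearMap.mul_apply']
  have : ∀ x : ℝ, Complex.exp (-w * x) * halfKern x * (Complex.exp (-w * ((t - x : ℝ) : ℂ)) * halfKern (t - x))
      = Complex.exp (-w * t) * ((halfKern x * halfKern (t - x) : ℝ) : ℂ) := by
    intro x
    rw [mul_mul_mul_comm, ← Complex.exp_add]
    push_cast
    ring_nf
  simp only [this]
  rw [intervalIntegral.integral_const_mul, intervalIntegral.integral_ofReal, integral_halfKern_mul ht]
  push_cast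
  ring

/-- The Laplace transform takes the one-sided convolution square to a square of beta integrals. The
half-plane contains the imaginary axis, where the modulus of this formula will control `dens`. -/
lemma integral_exp_mul_leg {w : ℂ} (hw : -(1 / 4) < w.re) :
    ∫ t in Ioi (0 : ℝ), Complex.exp (-w * t) * leg t
      = Complex.betaIntegral (w + 1 / 4) (1 / 2) ^ 2 / Real.pi := by
  have hi := integrableOn_exp_mul_halfKern hw
  have h := integral_posConvolution (μ := volume) (ν := volume) hi hi (ContinuousLinearMap.mul ℝ ℂ)
  have hpi : (Real.pi : ℂ) ≠ 0 := by exact_mod_cast Real.pi_ne_zero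
  rw [integral_exp_mul_halfKern, ContinuousLinearMap.mul_apply'] at h
  rw [eq_div_iff hpi, sq, ← h, mul_comm, ← integral_const_mul]
  refine setIntegral_congr_fun measurableSet_Ioi fun t ht => ?_
  have := exp_mul_leg_eq_posConvolution w ht
  rw [posConvolution, indicator_of_mem ht] at this
  exact this.symm

lemma integrableOn_exp_mul_leg {w : ℂ} (hw : -(1 / 4) < w.re) :
    IntegrableOn (fun t : ℝ => Complex.exp (-w * t) * leg t) (Ioi 0) := by
  have hi := integrableOn_exp_mul_halfKern hw
  have h := (integrable_posConvolution (μ := volume) (ν := volume) hi hi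
    (ContinuousLinearMap.mul ℝ ℂ)).integrableOn (s := Ioi 0)
  have hpi : (Real.pi : ℂ) ≠ 0 := by exact_mod_cast Real.pi_ne_zero
  have h2 := h.congr_fun (fun t ht => exp_mul_leg_eq_posConvolution w ht) measurableSet_Ioi
  refine IntegrableOn.congr_fun (h2.const_mul ((Real.pi : ℂ)⁻¹)) (fun t _ => ?_) measurableSet_Ioi
  rw [inv_mul_cancel_left₀ hpi]

/-! ### Oscillatory integrals and decay of the density -/

open FourierTransform

/-- The oscillatory integral of a bounded antitone function is at most half a period. -/
lemma norm_integral_exp_mul_antitone_le {P : ℝ → ℝ} (hP : AntitoneOn P (Ici 0))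
    (h0 : ∀ t, 0 ≤ P t) (h1 : P 0 ≤ 1) (hi : IntegrableOn P (Ioi 0)) {u : ℝ} (hu : 0 < u) :
    ‖∫ t in Ioi (0 : ℝ), Complex.exp (-(u * Complex.I) * t) * P t‖ ≤ Real.pi / u := by
  set h := Real.pi / u with hh
  have hpos : 0 < h := div_pos Real.pi_pos hu
  set Q : ℝ → ℝ := indicator (Ioi 0) P with hQ
  have hQi : Integrable Q := (integrable_indicator_iff measurableSet_Ioi).2 hi
  have hQh : Integrable fun t => Q (t + h) := hQi.comp_add_right h
  have hn : ∀ t : ℝ, ‖Complex.exp (-(u * Complex.I) * t)‖ = 1 := by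
    intro t
    rw [show -(u * Complex.I) * (t : ℂ) = ((-(u * t) : ℝ) : ℂ) * Complex.I by push_cast; ring,
      Complex.norm_exp_ofReal_mul_I]
  have hc : Continuous fun t : ℝ => Complex.exp (-(u * Complex.I) * t) := by fun_prop
  have hmul : ∀ g : ℝ → ℝ, Integrable g →
      Integrable fun t : ℝ => Complex.exp (-(u * Complex.I) * t) * (g t : ℂ) := fun g hg =>
    hg.ofReal.bdd_mul (c := 1) hc.aestronglyMeasurable (Eventually.of_forall fun t => (hn t).le)
  have e1 : ∫ t in Ioi (0 : ℝ), Complex.exp (-(u * Complex.I) * t) * P t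
      = ∫ t : ℝ, Complex.exp (-(u * Complex.I) * t) * Q t := by
    rw [← integral_indicator measurableSet_Ioi]
    congr 1 with t
    by_cases ht : t ∈ Ioi (0 : ℝ) <;> simp [hQ, ht]
  -- A shift by the half period h = π/u reverses the sign of the exponential, so twice the integral
  -- only sees the difference Q(t) - Q(t + h).
  have e2 : ∫ t : ℝ, Complex.exp (-(u * Complex.I) * t) * Q t
      = -∫ t : ℝ, Complex.exp (-(u * Complex.I) * t) * Q (t + h) := by
    rw [← integral_neg, ← integral_add_right_eq_self _ h]
    congr 1 with t
    have : Complex.exp (-(u * Complex.I) * ((t + h : ℝ) : ℂ)) = -Complex.exp (-(u * Complex.I) * t) := by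
      have hu' : (u : ℂ) ≠ 0 := by exact_mod_cast hu.ne'
      rw [show -(u * Complex.I) * ((t + h : ℝ) : ℂ)
        = -(u * Complex.I) * t - Real.pi * Complex.I by rw [hh]; push_cast; field_simp; ring,
        Complex.exp_sub, Complex.exp_pi_mul_I]
      ring
    rw [this, neg_mul]
  have e3 : 2 * ∫ t : ℝ, Complex.exp (-(u * Complex.I) * t) * Q t
      = ∫ t : ℝ, Complex.exp (-(u * Complex.I) * t) * ((Q t - Q (t + h) : ℝ) : ℂ) := by
    have : ∀ t : ℝ, Complex.exp (-(u * Complex.I) * t) * ((Q t - Q (t + h) : ℝ) : ℂ)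
        = Complex.exp (-(u * Complex.I) * t) * Q t - Complex.exp (-(u * Complex.I) * t) * Q (t + h) := by
      intro t; push_cast; ring
    simp only [this]
    rw [integral_sub (hmul _ hQi) (hmul _ hQh), two_mul]
    nth_rewrite 2 [e2]
    ring
  -- The difference is nonnegative except on (-h, 0], where the jump of Q at 0 makes it at least -1.
  -- Its total integral vanishes, so only the correction 2 on a strip of length h contributes.
  have hbound : ∀ t : ℝ, |Q t - Q (t + h)|
      ≤ (Q t - Q (t + h)) + 2 * indicator (Ioc (-h) 0) (fun _ => (1 : ℝ)) t := by
    intro t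
    by_cases ht : 0 < t
    · have a1 : Q t = P t := indicator_of_mem (show t ∈ Ioi (0 : ℝ) from ht) _
      have a2 : Q (t + h) = P (t + h) := indicator_of_mem (show t + h ∈ Ioi (0 : ℝ) from by simp; linarith) _
      have a3 : P (t + h) ≤ P t := hP ht.le (by simp; linarith) (by linarith)
      rw [a1, a2, abs_of_nonneg (by linarith), indicator_of_notMem (by simp [ht])]
      linarith
    · have a1 : Q t = 0 := indicator_of_notMem (by simpa using ht) _
      by_cases hth : 0 < t + h
      · have a2 : Q (t + h) = P (t + h) := indicator_of_mem (show t + h ∈ Ioi (0 : ℝ) from hth) _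
        have a3 : P (t + h) ≤ P 0 := hP (by simp) hth.le hth.le
        rw [a1, a2, indicator_of_mem (by constructor <;> linarith), abs_of_nonpos (by linarith [h0 (t + h)])]
        linarith
      · have a2 : Q (t + h) = 0 := indicator_of_notMem (by simpa using hth) _
        rw [a1, a2, indicator_of_notMem (by simp; intro; linarith)]
        simp
  have hI : Integrable (indicator (Ioc (-h) 0) (fun _ => (1 : ℝ))) :=
    (integrable_indicator_iff measurableSet_Ioc).2 (integrableOn_const (by simp))
  have e4 : ‖(2 : ℂ) * ∫ t : ℝ, Complex.exp (-(u * Complex.I) * t) * Q t‖ ≤ 2 * h := by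
    rw [e3]
    calc _ ≤ ∫ t : ℝ, ‖Complex.exp (-(u * Complex.I) * t) * ((Q t - Q (t + h) : ℝ) : ℂ)‖ :=
          norm_integral_le_integral_norm _
      _ = ∫ t : ℝ, |Q t - Q (t + h)| := by
          congr 1 with t
          rw [norm_mul, hn, one_mul, Complex.norm_real, Real.norm_eq_abs]
      _ ≤ ∫ t : ℝ, ((Q t - Q (t + h)) + 2 * indicator (Ioc (-h) 0) (fun _ => (1 : ℝ)) t) :=
          integral_mono (hQi.sub hQh).abs ((hQi.sub hQh).add (hI.const_mul 2)) hbound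
      _ = 2 * h := by
          have s1 : ∫ t : ℝ, (Q t - Q (t + h)) = 0 := by
            rw [integral_sub hQi hQh, integral_add_right_eq_self, sub_self]
          have s2 := integral_add (hQi.sub hQh) (hI.const_mul 2)
          simp only [Pi.sub_apply] at s2
          rw [s2, s1, integral_const_mul, integral_indicator measurableSet_Ioc]
          simp [hpos.le]
  rw [norm_mul, Complex.norm_ofNat] at e4
  rw [e1]
  linarith

lemma integrableOn_exp_mul_leg_real {x : ℝ} (hx : -(1 / 4) < x) :
    IntegrableOn (fun t : ℝ => Real.exp (-x * t) * leg t) (Ioi 0) := by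
  have h := (integrableOn_exp_mul_leg (w := x) (by simpa using hx)).re
  refine IntegrableOn.congr_fun h (fun t _ => ?_) measurableSet_Ioi
  simp only [RCLike.re_to_complex, Complex.re_mul_ofReal]
  rw [← Complex.ofReal_neg, ← Complex.ofReal_mul, Complex.exp_ofReal_re]

lemma integrableOn_leg : IntegrableOn leg (Ioi 0) := by
  simpa using integrableOn_exp_mul_leg_real (x := 0) (by norm_num)

/-- The density `|Γ(1/4 + iu)|⁴ / (2 π³)`. -/
noncomputable def dens (u : ℝ) : ℝ :=
  ‖Complex.Gamma (1 / 4 + u * Complex.I)‖ ^ 4 / (2 * Real.pi ^ 3)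

lemma dens_nonneg (u : ℝ) : 0 ≤ dens u := by
  have := Real.pi_pos
  unfold dens
  positivity

lemma norm_Gamma_neg (b u : ℝ) : ‖Complex.Gamma (b - u * Complex.I)‖ = ‖Complex.Gamma (b + u * Complex.I)‖ := by
  rw [← Complex.norm_conj, ← Complex.Gamma_conj]
  simp

lemma dens_neg (u : ℝ) : dens (-u) = dens u := by
  have := norm_Gamma_neg (1 / 4) u
  unfold dens
  push_cast at this ⊢
  rw [← this]
  ring_nf

lemma continuous_dens : Continuous dens := by
  unfold dens
  refine Continuous.div_const (Continuous.pow (Continuous.norm ?_) 4) _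
  refine continuous_iff_continuousAt.2 fun u => ?_
  refine ContinuousAt.comp (g := Complex.Gamma) ?_ (by fun_prop)
  refine (Complex.differentiableAt_Gamma _ fun m h => ?_).continuousAt
  have := congrArg Complex.re h
  simp at this
  have h2 : (0 : ℝ) ≤ m := m.cast_nonneg
  linarith

/-- Euler reflection at 1/4 + iu, with |sin(π/4 + iπu)|² = cosh(2πu)/2. -/
lemma norm_Gamma_mul_norm_Gamma (u : ℝ) :
    ‖Complex.Gamma (1 / 4 + u * Complex.I)‖ ^ 2 * ‖Complex.Gamma (3 / 4 + u * Complex.I)‖ ^ 2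
      = 2 * Real.pi ^ 2 / Real.cosh (2 * Real.pi * u) := by
  have h := Complex.Gamma_mul_Gamma_one_sub (1 / 4 + u * Complex.I)
  rw [show (1 : ℂ) - (1 / 4 + u * Complex.I) = 3 / 4 - u * Complex.I by ring] at h
  have h2 := norm_Gamma_neg (3 / 4) u
  push_cast at h2
  rw [← h2, ← mul_pow, ← norm_mul, h, norm_div, Complex.norm_real, Real.norm_of_nonneg Real.pi_pos.le,
    div_pow]
  have h3 : ‖Complex.sin (Real.pi * (1 / 4 + u * Complex.I))‖ ^ 2 = Real.cosh (2 * Real.pi * u) / 2 := by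
    rw [show (Real.pi : ℂ) * (1 / 4 + u * Complex.I)
      = ((Real.pi / 4 : ℝ) : ℂ) + ((Real.pi * u : ℝ) : ℂ) * Complex.I by push_cast; ring, Complex.sin_add_mul_I,
      ← Complex.ofReal_sin, ← Complex.ofReal_cos, ← Complex.ofReal_cosh, ← Complex.ofReal_sinh,
      ← Complex.ofReal_mul, ← Complex.ofReal_mul, Complex.sq_norm, Complex.normSq_add_mul_I,
      Real.sin_pi_div_four, Real.cos_pi_div_four, mul_assoc 2, Real.cosh_two_mul, mul_pow, mul_pow, div_pow,
      Real.sq_sqrt (by norm_num)]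
    ring
  rw [h3]
  have := Real.cosh_pos (2 * Real.pi * u)
  field_simp

/-- The transform on the imaginary axis is a quotient of Gamma values at 1/4 + iu and 3/4 + iu;
reflection eliminates the latter and leaves `dens`. -/
lemma norm_integral_exp_mul_leg (u : ℝ) :
    ‖∫ t in Ioi (0 : ℝ), Complex.exp (-(u * Complex.I) * t) * leg t‖
      = dens u * (Real.pi * Real.cosh (2 * Real.pi * u)) := by
  have hp := Real.pi_pos
  have hc := Real.cosh_pos (2 * Real.pi * u)
  rw [integral_exp_mul_leg (by simp), Complex.betaIntegral_eq_Gamma_mul_div _ _ (by simp) (by simp),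
    Complex.Gamma_one_half_eq, show (u * Complex.I + 1 / 4 + 1 / 2 : ℂ) = 3 / 4 + u * Complex.I by ring,
    add_comm _ (1 / 4 : ℂ)]
  have h1 : ‖(Real.pi : ℂ) ^ (1 / 2 : ℂ)‖ ^ 2 = Real.pi := by
    rw [Complex.norm_cpow_eq_rpow_re_of_pos hp, ← Real.rpow_natCast, ← Real.rpow_mul hp.le]
    norm_num
  rw [norm_div, norm_pow, norm_div, norm_mul, div_pow, mul_pow, h1, Complex.norm_real,
    Real.norm_of_nonneg hp.le]
  have h2 := norm_Gamma_mul_norm_Gamma u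
  have h3 : 0 < ‖Complex.Gamma (3 / 4 + u * Complex.I)‖ :=
    norm_pos_iff.2 (Complex.Gamma_ne_zero_of_re_pos (by simp))
  unfold dens
  rw [eq_div_iff hc.ne'] at h2
  have h4 : Real.pi ^ 2 = ‖Complex.Gamma (1 / 4 + u * Complex.I)‖ ^ 2 *
      ‖Complex.Gamma (3 / 4 + u * Complex.I)‖ ^ 2 * Real.cosh (2 * Real.pi * u) / 2 := by linarith
  rw [pow_succ Real.pi 2, h4]
  have h5 : 0 < ‖Complex.Gamma (1 / 4 + u * Complex.I)‖ :=
    norm_pos_iff.2 (Complex.Gamma_ne_zero_of_re_pos (by simp))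
  field_simp

/-- Since `leg` decreases from `leg 0 = 1`, its one-sided Fourier integral is at most π/u. The sharp
constant 1 matters later, in `mul_stepAvg_lt_sechAvg`. -/
lemma abs_mul_dens_mul_cosh_le (u : ℝ) : |u| * dens u * Real.cosh (2 * Real.pi * u) ≤ 1 := by
  have hp := Real.pi_pos
  have key : ∀ u : ℝ, 0 < u → u * dens u * Real.cosh (2 * Real.pi * u) ≤ 1 := by
    intro u hu
    have h := norm_integral_exp_mul_antitone_le leg_antitoneOn leg_nonneg leg_zero.le integrableOn_leg hu
    rw [norm_integral_exp_mul_leg, le_div_iff₀ hu] at h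
    have : Real.pi * (u * dens u * Real.cosh (2 * Real.pi * u)) ≤ Real.pi * 1 := by linarith
    exact le_of_mul_le_mul_left this hp
  rcases lt_trichotomy u 0 with h | h | h
  · have := key (-u) (by linarith)
    rwa [dens_neg, mul_neg, Real.cosh_neg, ← abs_of_neg h] at this
  · simp [h]
  · rw [abs_of_pos h]; exact key u h

lemma exists_dens_le : ∃ C, 0 < C ∧ ∀ u, dens u ≤ C * (1 / (2 * Real.cosh (2 * Real.pi * u))) := by
  have hp := Real.pi_pos
  -- The `+ 1` makes positivity of the constant immediate.
  refine ⟨2 / Real.pi * ((∫ t in Ioi (0 : ℝ), leg t) + 1), ?_, fun u => ?_⟩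
  · have : 0 ≤ ∫ t in Ioi (0 : ℝ), leg t := integral_nonneg leg_nonneg
    positivity
  · have hc := Real.cosh_pos (2 * Real.pi * u)
    have h := norm_integral_exp_mul_leg u
    have h2 : ‖∫ t in Ioi (0 : ℝ), Complex.exp (-(u * Complex.I) * t) * leg t‖
        ≤ ∫ t in Ioi (0 : ℝ), leg t := by
      refine (norm_integral_le_integral_norm _).trans_eq ?_
      congr 1 with t
      rw [norm_mul, show -(u * Complex.I) * (t : ℂ) = ((-(u * t) : ℝ) : ℂ) * Complex.I by push_cast; ring,
        Complex.norm_exp_ofReal_mul_I, one_mul, Complex.norm_real, Real.norm_of_nonneg (leg_nonneg t)]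
    rw [h] at h2
    have h3 : dens u ≤ ((∫ t in Ioi (0 : ℝ), leg t) + 1) / (Real.pi * Real.cosh (2 * Real.pi * u)) := by
      rw [le_div_iff₀ (by positivity)]; linarith
    refine h3.trans_eq ?_
    field_simp

lemma integrable_dens : Integrable dens := by
  obtain ⟨C, hC, h⟩ := exists_dens_le
  refine ((integrable_sech_scaled (c := 2 * Real.pi) (by positivity)).const_mul C).mono'
    continuous_dens.aestronglyMeasurable (Eventually.of_forall fun u => ?_)
  rw [Real.norm_of_nonneg (dens_nonneg u)]
  exact h u

/-! ### `leg` as the Fourier transform of the density -/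

lemma fourier_kern (ξ : ℝ) : 𝓕 (fun x => (kern x : ℂ)) ξ
    = ((‖Complex.Gamma (1 / 4 + (2 * Real.pi * ξ : ℝ) * Complex.I)‖ ^ 2 / √Real.pi : ℝ) : ℂ) := by
  rw [Real.fourier_real_eq_integral_exp_smul]
  have h := integral_exp_mul_cosh_rpow (b := 1 / 4) (by norm_num) (-(2 * Real.pi * ξ))
  simp only [← kern_eq_rpow] at h
  have e : ∀ v : ℝ, Complex.exp (((-2 * Real.pi * v * ξ : ℝ) : ℂ) * Complex.I) • (kern v : ℂ)
      = Complex.exp (((-(2 * Real.pi * ξ) : ℝ) : ℂ) * v * Complex.I) * kern v := by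
    intro v
    rw [smul_eq_mul]
    congr 2
    push_cast; ring
  simp only [e]
  rw [h]
  have e2 : (((1 / 4 : ℝ) : ℂ) + ((-(2 * Real.pi * ξ) : ℝ) : ℂ) * Complex.I)
      = (starRingEnd ℂ) (1 / 4 + (2 * Real.pi * ξ : ℝ) * Complex.I) := by
    rw [map_add, map_mul, Complex.conj_I, Complex.conj_ofReal, map_div₀, map_one, map_ofNat]
    push_cast; ring
  have e3 : (((1 / 4 : ℝ) : ℂ) - ((-(2 * Real.pi * ξ) : ℝ) : ℂ) * Complex.I)
      = (1 / 4 + (2 * Real.pi * ξ : ℝ) * Complex.I) := by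
    push_cast; ring
  rw [e2, e3, Complex.Gamma_conj, mul_comm, Complex.mul_conj, Complex.normSq_eq_norm_sq,
    show (2 * ((1 / 4 : ℝ) : ℂ)) = ((1 / 2 : ℝ) : ℂ) by push_cast; ring, Complex.Gamma_ofReal,
    Real.Gamma_one_half_eq]
  push_cast
  rfl

/-- Fourier inversion for the convolution square of `kern`: its transform is the square of that of
`kern`, which is `dens` up to scaling, and is integrable by the decay bound. -/
lemma integral_exp_mul_dens (t : ℝ) :
    ∫ u : ℝ, Complex.exp (t * u * Complex.I) * dens u = leg t := by
  have hp := Real.pi_pos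
  set f : ℝ → ℂ := fun x => (kern x : ℂ) with hf
  have hfi : Integrable f := integrable_kern.ofReal
  set g := convolution f f (ContinuousLinearMap.mul ℂ ℂ) volume with hg
  have hgi : Integrable g := hfi.integrable_convolution _ hfi
  have hgc : Continuous g := by
    refine BddAbove.continuous_convolution_right_of_integrable _ ⟨1, ?_⟩ hfi
      (Complex.continuous_ofReal.comp continuous_kern)
    rintro _ ⟨x, rfl⟩
    simp only [hf]
    rw [Complex.norm_real, Real.norm_of_nonneg (kern_pos x).le]
    exact kern_le_one x
  have hgl : ∀ s, g s = ((Real.pi * leg s : ℝ) : ℂ) := by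
    intro s
    simp only [hg, convolution, ContinuousLinearMap.mul_apply', hf]
    rw [leg, ← mul_assoc, mul_one_div_cancel hp.ne', one_mul, ← integral_complex_ofReal]
    simp
  have hF : 𝓕 g = fun ξ => ((2 * Real.pi ^ 2 * dens (2 * Real.pi * ξ) : ℝ) : ℂ) := by
    ext ξ
    rw [hg, Real.fourier_mul_convolution_eq hfi hfi, hf, fourier_kern, ← Complex.ofReal_mul]
    congr 1
    rw [dens, div_mul_div_comm, Real.mul_self_sqrt hp.le]
    field_simp
  have hFi : Integrable (𝓕 g) := by
    rw [hF]
    exact ((integrable_dens.comp_mul_left' (by positivity)).const_mul _).ofReal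
  have h := congrFun (hgc.fourierInv_fourier_eq hgi hFi) t
  rw [hF, Real.fourierInv_eq', hgl] at h
  have h2 := Measure.integral_comp_mul_left
    (fun u : ℝ => Complex.exp (t * u * Complex.I) * dens u) (2 * Real.pi)
  rw [abs_of_pos (by positivity)] at h2
  have e : ∀ v : ℝ, Complex.exp (((2 * Real.pi * inner ℝ v t : ℝ) : ℂ) * Complex.I) •
      ((2 * Real.pi ^ 2 * dens (2 * Real.pi * v) : ℝ) : ℂ)
      = (2 * Real.pi ^ 2 : ℝ) * (Complex.exp (t * (2 * Real.pi * v : ℝ) * Complex.I) * dens (2 * Real.pi * v)) := by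
    intro v
    simp only [RCLike.inner_apply, conj_trivial, smul_eq_mul]
    push_cast
    ring_nf
  simp only [e] at h
  rw [integral_const_mul, h2, Complex.real_smul, ← mul_assoc, ← Complex.ofReal_mul] at h
  have h3 : 2 * Real.pi ^ 2 * (2 * Real.pi)⁻¹ = Real.pi := by field_simp
  rw [h3, Complex.ofReal_mul] at h
  exact mul_left_cancel₀ (by exact_mod_cast hp.ne') h

lemma integral_dens_mul_cos (t : ℝ) : ∫ u : ℝ, dens u * Real.cos (t * u) = leg t := by
  have h := congrArg Complex.re (integral_exp_mul_dens t)
  rw [← RCLike.re_eq_complex_re, ← integral_re] at h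
  · rw [RCLike.re_eq_complex_re, Complex.ofReal_re] at h
    rw [← h]
    congr 1 with u
    rw [Complex.re_mul_ofReal, ← Complex.ofReal_mul, Complex.exp_ofReal_mul_I_re,
      mul_comm]
  · refine integrable_dens.ofReal.bdd_mul (c := 1) (by fun_prop) (Eventually.of_forall fun u => ?_)
    rw [← Complex.ofReal_mul, Complex.norm_exp_ofReal_mul_I]

lemma integral_dens : ∫ u : ℝ, dens u = 1 := by
  simpa [leg_zero] using integral_dens_mul_cos 0

lemma continuous_leg : Continuous leg := by
  have : leg = fun t => ∫ u : ℝ, dens u * Real.cos (t * u) := by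
    ext t; exact (integral_dens_mul_cos t).symm
  rw [this]
  refine continuous_of_dominated (bound := dens) (fun t => ?_) (fun t => ?_) integrable_dens ?_
  · exact (continuous_dens.mul (by fun_prop)).aestronglyMeasurable
  · filter_upwards with u
    rw [norm_mul, Real.norm_of_nonneg (dens_nonneg u)]
    exact mul_le_of_le_one_right (dens_nonneg u) (Real.abs_cos_le_one _)
  · filter_upwards with u
    fun_prop

/-- The `k`-th term of the sum defining the Landau constants. -/
noncomputable def term (k : ℕ) : ℝ :=
  (∏ j ∈ Finset.range k, (2 * (j : ℝ) + 1) / (2 * (j : ℝ) + 2)) ^ 2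

lemma Gamma_half_eq_prod (k : ℕ) : Real.Gamma (k + 1 / 2) / Real.Gamma (k + 1)
    = √Real.pi * ∏ j ∈ Finset.range k, (2 * (j : ℝ) + 1) / (2 * (j : ℝ) + 2) := by
  induction k with
  | zero => simp [Real.Gamma_one_half_eq, -one_div]
  | succ k ih =>
    rw [Finset.prod_range_succ, ← mul_assoc, ← ih]
    push_cast
    rw [show (k : ℝ) + 1 + 1 / 2 = (k + 1 / 2) + 1 by ring, Real.Gamma_add_one (by positivity),
      Real.Gamma_add_one (s := (k : ℝ) + 1) (by positivity)]
    have := Real.Gamma_pos_of_pos (s := (k : ℝ) + 1) (by positivity)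
    field_simp

/-- At w = k + 1/4 the beta parameters are k + 1/2 and 1/2, and the beta value is π times a Wallis
ratio. -/
lemma integral_exp_mul_leg_nat (k : ℕ) :
    ∫ t in Ioi (0 : ℝ), Real.exp (-((k : ℝ) + 1 / 4) * t) * leg t = Real.pi * term k := by
  have hp := Real.pi_pos
  have hk : (0 : ℝ) ≤ k := k.cast_nonneg
  have h := integral_exp_mul_leg (w := ((k + 1 / 4 : ℝ) : ℂ)) (by
    rw [Complex.ofReal_re]; linarith)
  have e : ∀ t : ℝ, Complex.exp (-((k + 1 / 4 : ℝ) : ℂ) * t) * leg t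
      = ((Real.exp (-((k : ℝ) + 1 / 4) * t) * leg t : ℝ) : ℂ) := by
    intro t; push_cast; rfl
  simp only [e] at h
  rw [integral_complex_ofReal, Complex.betaIntegral_eq_Gamma_mul_div] at h
  · rw [show (((k + 1 / 4 : ℝ) : ℂ) + 1 / 4) = ((k + 1 / 2 : ℝ) : ℂ) by push_cast; ring,
      show (((k + 1 / 2 : ℝ) : ℂ) + 1 / 2) = ((k + 1 : ℝ) : ℂ) by push_cast; ring,
      show (1 / 2 : ℂ) = ((1 / 2 : ℝ) : ℂ) by push_cast; ring,
      Complex.Gamma_ofReal, Complex.Gamma_ofReal, Complex.Gamma_ofReal, mul_div_right_comm,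
      ← Complex.ofReal_div, Gamma_half_eq_prod, Real.Gamma_one_half_eq] at h
    have h2 : ∫ t in Ioi (0 : ℝ), Real.exp (-((k : ℝ) + 1 / 4) * t) * leg t
        = (√Real.pi * (∏ j ∈ Finset.range k, (2 * (j : ℝ) + 1) / (2 * (j : ℝ) + 2)) * √Real.pi) ^ 2
          / Real.pi := by
      exact_mod_cast h
    rw [h2, term, mul_right_comm, Real.mul_self_sqrt hp.le]
    field_simp
  · rw [Complex.add_re, Complex.ofReal_re]; norm_num; linarith
  · norm_num


/-! ### Averages of the hyperbolic secant and of a smoothed step -/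

/-- The kernel `1 / (2 cosh x)`. -/
noncomputable def sechKer (x : ℝ) : ℝ := 1 / (2 * Real.cosh x)

/-- The smoothed step `1 / (1 + e^{2x})`. -/
noncomputable def stepKer (x : ℝ) : ℝ := 1 / (1 + Real.exp (2 * x))

/-- The average of `1 / (2 cosh (2π(y - u)))` against the density. -/
noncomputable def sechAvg (y : ℝ) : ℝ := ∫ u, dens u * sechKer (2 * Real.pi * (y - u))

/-- The average of `1 / (1 + e^{4π(y - u)})` against the density. -/
noncomputable def stepAvg (y : ℝ) : ℝ := ∫ u, dens u * stepKer (2 * Real.pi * (y - u))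

/-- The average of `1 / (2 cosh (2π(y - u)))²` against the density. -/
noncomputable def sqAvg (y : ℝ) : ℝ := ∫ u, dens u * sechKer (2 * Real.pi * (y - u)) ^ 2

lemma sechKer_pos (x : ℝ) : 0 < sechKer x := by
  have := Real.cosh_pos x
  unfold sechKer; positivity

lemma stepKer_pos (x : ℝ) : 0 < stepKer x := by unfold stepKer; positivity

lemma sechKer_neg (x : ℝ) : sechKer (-x) = sechKer x := by rw [sechKer, sechKer, Real.cosh_neg]

lemma continuous_sechKer : Continuous sechKer := by
  unfold sechKer
  exact continuous_const.div (by fun_prop) fun x => by have := Real.cosh_pos x; positivity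

lemma continuous_stepKer : Continuous stepKer := by
  unfold stepKer
  exact continuous_const.div (by fun_prop) fun x => by positivity

lemma sechKer_le_one (x : ℝ) : sechKer x ≤ 1 := by
  rw [sechKer, div_le_one (by linarith [Real.one_le_cosh x])]
  linarith [Real.one_le_cosh x]

lemma stepKer_le_one (x : ℝ) : stepKer x ≤ 1 := by
  rw [stepKer, div_le_one (by positivity)]
  linarith [Real.exp_pos (2 * x)]

lemma stepKer_eq (x : ℝ) : stepKer x = Real.exp (-x) * sechKer x := by
  rw [stepKer, sechKer, Real.cosh_eq, two_mul, Real.exp_add, Real.exp_neg]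
  field_simp
  ring

lemma stepKer_neg (x : ℝ) : stepKer (-x) = 1 - stepKer x := by
  rw [stepKer, stepKer, mul_neg, Real.exp_neg]
  field_simp
  ring

lemma sechKer_le_exp (x : ℝ) : sechKer x ≤ Real.exp (-x / 2) := by
  have h1 := Real.exp_pos (x / 2)
  rw [sechKer, neg_div, Real.exp_neg, ← one_div]
  refine one_div_le_one_div_of_le h1 ?_
  rw [Real.cosh_eq]
  rcases le_total 0 x with h | h
  · have := Real.exp_le_exp.2 (show x / 2 ≤ x by linarith)
    linarith [Real.exp_pos (-x)]
  · have := Real.exp_le_exp.2 (show x / 2 ≤ -x by linarith)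
    linarith [Real.exp_pos x]

lemma stepKer_le_exp (x : ℝ) : stepKer x ≤ Real.exp (-x / 2) := by
  have h1 := Real.exp_pos (x / 2)
  rw [stepKer, neg_div, Real.exp_neg, ← one_div]
  refine one_div_le_one_div_of_le h1 ?_
  rcases le_total 0 x with h | h
  · have := Real.exp_le_exp.2 (show x / 2 ≤ 2 * x by linarith)
    linarith
  · have := Real.exp_le_one_iff.2 (show x / 2 ≤ 0 by linarith)
    linarith [Real.exp_pos (2 * x)]

lemma integrable_sechKer_scaled {c : ℝ} (hc : c ≠ 0) : Integrable fun y => sechKer (c * y) :=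
  integrable_sech_scaled hc

lemma integrable_dens_mul {g : ℝ → ℝ} (hg : Continuous g) {c : ℝ} (hb : ∀ x, |g x| ≤ c) :
    Integrable fun u => dens u * g u :=
  integrable_dens.mul_bdd (c := c) hg.aestronglyMeasurable (Eventually.of_forall hb)

lemma abs_sechKer_le (x : ℝ) : |sechKer x| ≤ 1 := by
  rw [abs_of_pos (sechKer_pos x)]; exact sechKer_le_one x

lemma abs_stepKer_le (x : ℝ) : |stepKer x| ≤ 1 := by
  rw [abs_of_pos (stepKer_pos x)]; exact stepKer_le_one x

lemma integrable_dens_sech (y : ℝ) : Integrable fun u => dens u * sechKer (2 * Real.pi * (y - u)) :=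
  integrable_dens_mul (continuous_sechKer.comp (by fun_prop)) fun _ => abs_sechKer_le _

lemma integrable_dens_step (y : ℝ) : Integrable fun u => dens u * stepKer (2 * Real.pi * (y - u)) :=
  integrable_dens_mul (continuous_stepKer.comp (by fun_prop)) fun _ => abs_stepKer_le _

lemma dens_pos (u : ℝ) : 0 < dens u := by
  have h5 : 0 < ‖Complex.Gamma (1 / 4 + u * Complex.I)‖ :=
    norm_pos_iff.2 (Complex.Gamma_ne_zero_of_re_pos (by simp))
  have := Real.pi_pos
  unfold dens
  positivity

lemma integral_dens_mul_pos {g : ℝ → ℝ} (hg : ∀ u, 0 < g u) (hi : Integrable fun u => dens u * g u) :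
    0 < ∫ u, dens u * g u := by
  have hpos : ∀ u, 0 < dens u * g u := fun u => mul_pos (dens_pos u) (hg u)
  rw [integral_pos_iff_support_of_nonneg (fun u => (hpos u).le) hi]
  have : Function.support (fun u => dens u * g u) = univ := by
    ext u; simpa using (hpos u).ne'
  rw [this]
  simp

lemma sechAvg_pos (y : ℝ) : 0 < sechAvg y :=
  integral_dens_mul_pos (fun _ => sechKer_pos _) (integrable_dens_sech y)

lemma stepAvg_pos (y : ℝ) : 0 < stepAvg y :=
  integral_dens_mul_pos (fun _ => stepKer_pos _) (integrable_dens_step y)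

lemma integral_dens_comp_neg (g : ℝ → ℝ) : ∫ u, dens u * g (-u) = ∫ u, dens u * g u := by
  rw [← integral_neg_eq_self fun u => dens u * g u]
  simp only [dens_neg]

lemma sechAvg_neg (y : ℝ) : sechAvg (-y) = sechAvg y := by
  rw [sechAvg, sechAvg, ← integral_dens_comp_neg]
  congr 1 with u
  rw [← sechKer_neg]
  ring_nf

lemma stepAvg_zero : stepAvg 0 = 1 / 2 := by
  have h1 : stepAvg 0 = ∫ u, dens u * stepKer (2 * Real.pi * (0 - -u)) := by
    rw [stepAvg, ← integral_dens_comp_neg]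
  have h2 : ∫ u, dens u * stepKer (2 * Real.pi * (0 - -u)) = 1 - stepAvg 0 := by
    rw [stepAvg, ← integral_dens, ← integral_sub integrable_dens (integrable_dens_step 0)]
    congr 1 with u
    rw [show 2 * Real.pi * (0 - -u) = -(2 * Real.pi * (0 - u)) by ring, stepKer_neg]
    ring
  linarith

lemma continuous_dens_avg {g : ℝ → ℝ} (hg : Continuous g) {c : ℝ} (hb : ∀ x, |g x| ≤ c) :
    Continuous fun y => ∫ u, dens u * g (2 * Real.pi * (y - u)) := by
  refine continuous_of_dominated (bound := fun u => dens u * c) (fun y => ?_) (fun y => ?_)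
    (integrable_dens.mul_const c) ?_
  · exact (continuous_dens.mul (hg.comp (by fun_prop))).aestronglyMeasurable
  · filter_upwards with u
    rw [norm_mul, Real.norm_of_nonneg (dens_nonneg u)]
    exact mul_le_mul_of_nonneg_left (hb _) (dens_nonneg u)
  · filter_upwards with u
    exact continuous_const.mul (hg.comp (by fun_prop))

lemma continuous_sechAvg : Continuous sechAvg := continuous_dens_avg continuous_sechKer abs_sechKer_le

lemma continuous_stepAvg : Continuous stepAvg := continuous_dens_avg continuous_stepKer abs_stepKer_le

lemma abs_sechKer_sq_le (x : ℝ) : |sechKer x ^ 2| ≤ 1 := by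
  rw [abs_pow]
  exact pow_le_one₀ (abs_nonneg _) (abs_sechKer_le x)

lemma integrable_dens_sq (y : ℝ) : Integrable fun u => dens u * sechKer (2 * Real.pi * (y - u)) ^ 2 :=
  integrable_dens_mul (g := fun u => sechKer (2 * Real.pi * (y - u)) ^ 2)
    ((continuous_sechKer.comp (by fun_prop)).pow 2) fun _ => abs_sechKer_sq_le _

lemma continuous_sqAvg : Continuous sqAvg :=
  continuous_dens_avg (g := fun x => sechKer x ^ 2) (continuous_sechKer.pow 2) abs_sechKer_sq_le

lemma hasDerivAt_stepKer (x : ℝ) : HasDerivAt stepKer (-2 * sechKer x ^ 2) x := by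
  have h1 : HasDerivAt (fun x => 1 + Real.exp (2 * x)) (2 * Real.exp (2 * x)) x := by
    have := ((Real.hasDerivAt_exp (2 * x)).comp x ((hasDerivAt_id x).const_mul 2)).const_add 1
    simpa [mul_comm, Function.comp_def] using this
  have h2 := (hasDerivAt_const x (1 : ℝ)).div h1 (by positivity)
  refine h2.congr_deriv ?_
  rw [sechKer, Real.cosh_eq, two_mul x, Real.exp_add, Real.exp_neg]
  field_simp
  ring

/-- Needed because the step itself is not integrable on the line: its sine transform is obtained by
parts from the transform of sech². -/
lemma hasDerivAt_stepAvg (y : ℝ) : HasDerivAt stepAvg (-(4 * Real.pi) * sqAvg y) y := by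
  have h := hasDerivAt_integral_of_dominated_loc_of_deriv_le (μ := volume) (s := univ) (x₀ := y)
    (bound := fun u => dens u * (4 * Real.pi))
    (F := fun y u => dens u * stepKer (2 * Real.pi * (y - u)))
    (F' := fun y u => dens u * (-(4 * Real.pi) * sechKer (2 * Real.pi * (y - u)) ^ 2))
    univ_mem (Eventually.of_forall fun z => (integrable_dens_step z).aestronglyMeasurable)
    (integrable_dens_step y) ?_ ?_ (integrable_dens.mul_const _) ?_
  · refine h.2.congr_deriv ?_
    rw [sqAvg, ← integral_const_mul]
    congr 1 with u
    ring
  · exact (continuous_dens.mul (continuous_const.mul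
      ((continuous_sechKer.comp (by fun_prop)).pow 2))).aestronglyMeasurable
  · refine Eventually.of_forall fun u z _ => ?_
    have hp := Real.pi_pos
    rw [norm_mul, Real.norm_of_nonneg (dens_nonneg u), norm_mul, norm_neg,
      Real.norm_of_nonneg (by positivity : 0 ≤ 4 * Real.pi)]
    exact mul_le_mul_of_nonneg_left (mul_le_of_le_one_right (by positivity) (abs_sechKer_sq_le _))
      (dens_nonneg u)
  · refine Eventually.of_forall fun u z _ => ?_
    have h1 : HasDerivAt (fun z => 2 * Real.pi * (z - u)) (2 * Real.pi) z := by
      simpa using ((hasDerivAt_id z).sub_const u).const_mul (2 * Real.pi)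
    have h2 := ((hasDerivAt_stepKer (2 * Real.pi * (z - u))).comp z h1).const_mul (dens u)
    refine h2.congr_deriv ?_
    ring

lemma integrable_dens_mul_exp : Integrable fun u => dens u * Real.exp (Real.pi * u) := by
  obtain ⟨C, hC, h⟩ := exists_dens_le
  have hp := Real.pi_pos
  refine ((integrable_sech_scaled (c := Real.pi) hp.ne').const_mul (2 * C)).mono'
    (continuous_dens.mul (by fun_prop)).aestronglyMeasurable (Eventually.of_forall fun u => ?_)
  rw [Real.norm_of_nonneg (mul_nonneg (dens_nonneg u) (Real.exp_pos _).le)]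
  refine (mul_le_mul_of_nonneg_right (h u) (Real.exp_pos _).le).trans ?_
  rw [mul_assoc C, mul_comm 2 C, mul_assoc C]
  refine mul_le_mul_of_nonneg_left ?_ hC.le
  have hX := Real.exp_pos (Real.pi * u)
  rw [show 2 * Real.pi * u = Real.pi * u + Real.pi * u by ring, Real.cosh_eq, Real.cosh_eq, neg_add,
    Real.exp_add, Real.exp_add, Real.exp_neg]
  set X := Real.exp (Real.pi * u)
  field_simp
  -- The inequality amounts to X⁴ + X² ≤ 2(X⁴ + 1).
  nlinarith [sq_nonneg (X ^ 2 - 1), sq_nonneg X]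

lemma dens_avg_le_exp {g : ℝ → ℝ} (hb : ∀ x, g x ≤ Real.exp (-x / 2))
    (hi : ∀ y : ℝ, Integrable fun u => dens u * g (2 * Real.pi * (y - u))) (y : ℝ) :
    ∫ u, dens u * g (2 * Real.pi * (y - u))
      ≤ (∫ u, dens u * Real.exp (Real.pi * u)) * Real.exp (-Real.pi * y) := by
  rw [← integral_mul_const]
  refine integral_mono (hi y) (integrable_dens_mul_exp.mul_const _) fun u => ?_
  dsimp only
  rw [mul_assoc (dens u), ← Real.exp_add]
  refine mul_le_mul_of_nonneg_left ((hb _).trans_eq ?_) (dens_nonneg u)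
  congr 1; ring

lemma sechAvg_le_exp (y : ℝ) :
    sechAvg y ≤ (∫ u, dens u * Real.exp (Real.pi * u)) * Real.exp (-Real.pi * y) :=
  dens_avg_le_exp sechKer_le_exp integrable_dens_sech y

lemma stepAvg_le_exp (y : ℝ) :
    stepAvg y ≤ (∫ u, dens u * Real.exp (Real.pi * u)) * Real.exp (-Real.pi * y) :=
  dens_avg_le_exp stepKer_le_exp integrable_dens_step y

lemma sqAvg_le_sechAvg (y : ℝ) : sqAvg y ≤ sechAvg y := by
  refine integral_mono (integrable_dens_sq y) (integrable_dens_sech y) fun u => ?_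
  refine mul_le_mul_of_nonneg_left ?_ (dens_nonneg u)
  rw [sq]
  exact mul_le_of_le_one_left (sechKer_pos _).le (sechKer_le_one _)

lemma sqAvg_nonneg (y : ℝ) : 0 ≤ sqAvg y :=
  integral_nonneg fun u => mul_nonneg (dens_nonneg u) (sq_nonneg _)

/-! ### Fourier transforms of the averages -/

/-- An average against `dens` is a convolution, and `leg` is the transform of `dens`. -/
lemma integral_exp_mul_dens_avg {g : ℝ → ℝ} (hg : Integrable g) (t : ℝ) :
    ∫ y : ℝ, Complex.exp (t * y * Complex.I) * ((∫ u, dens u * g (y - u) : ℝ) : ℂ)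
      = leg t * ∫ y : ℝ, Complex.exp (t * y * Complex.I) * g y := by
  have hb : ∀ {f : ℝ → ℝ}, Integrable f →
      Integrable fun y : ℝ => Complex.exp (t * y * Complex.I) * (f y : ℂ) := fun hf =>
    hf.ofReal.bdd_mul (c := 1) (by fun_prop) (Eventually.of_forall fun u => by
      rw [← Complex.ofReal_mul, Complex.norm_exp_ofReal_mul_I])
  have h := integral_convolution (μ := volume) (ν := volume) (ContinuousLinearMap.mul ℝ ℂ)
    (hb integrable_dens) (hb hg)
  rw [ContinuousLinearMap.mul_apply', integral_exp_mul_dens] at h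
  rw [← h]
  congr 1 with y
  rw [convolution, ← integral_complex_ofReal, ← integral_const_mul]
  congr 1 with u
  rw [ContinuousLinearMap.mul_apply', mul_mul_mul_comm, ← Complex.exp_add]
  push_cast
  ring_nf

lemma integral_exp_mul_sechAvg (t : ℝ) :
    ∫ y : ℝ, Complex.exp (t * y * Complex.I) * sechAvg y
      = ((leg t * (1 / (4 * Real.cosh (t / 4))) : ℝ) : ℂ) := by
  have hp := Real.pi_pos
  have h := integral_exp_mul_dens_avg (integrable_sech_scaled (c := 2 * Real.pi) (by positivity)) t
  rw [integral_exp_mul_sech_scaled (by positivity), ← Complex.ofReal_mul] at h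
  refine h.trans ?_
  have : Real.pi * t / (2 * (2 * Real.pi)) = t / 4 := by field_simp; ring
  rw [this]
  congr 2
  field_simp
  norm_num

lemma integral_exp_mul_sqAvg {t : ℝ} (ht : t ≠ 0) :
    ∫ y : ℝ, Complex.exp (t * y * Complex.I) * sqAvg y
      = ((leg t * (t / (16 * Real.pi) / Real.sinh (t / 4)) : ℝ) : ℂ) := by
  have hp := Real.pi_pos
  have h := integral_exp_mul_dens_avg (integrable_sech_sq_scaled (c := 2 * Real.pi) (by positivity)) t
  rw [integral_exp_mul_sech_sq_scaled (by positivity) ht, ← Complex.ofReal_mul] at h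
  have e : ∀ y : ℝ, sqAvg y = ∫ u, dens u * (1 / (2 * Real.cosh (2 * Real.pi * (y - u))) ^ 2) := by
    intro y
    simp only [sqAvg, sechKer, one_div, inv_pow]
  simp only [e]
  refine h.trans ?_
  have : Real.pi * t / (2 * (2 * Real.pi)) = t / 4 := by field_simp; ring
  rw [this]
  congr 2
  field_simp
  norm_num

lemma integral_Ioi_mul_cos_of_even {f : ℝ → ℝ} (hf : ∀ y, f (-y) = f y) (hi : Integrable f) {t c : ℝ}
    (h : ∫ y : ℝ, Complex.exp (t * y * Complex.I) * f y = (c : ℂ)) :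
    ∫ y in Ioi (0 : ℝ), f y * Real.cos (t * y) = c / 2 := by
  have h1 := congrArg Complex.re h
  rw [← RCLike.re_eq_complex_re, ← integral_re] at h1
  · rw [RCLike.re_eq_complex_re, Complex.ofReal_re] at h1
    have h2 := integral_comp_abs (f := fun y => f y * Real.cos (t * y))
    have h3 : ∀ y : ℝ, f |y| * Real.cos (t * |y|) = (Complex.exp (t * y * Complex.I) * f y).re := by
      intro y
      rw [Complex.re_mul_ofReal, ← Complex.ofReal_mul, Complex.exp_ofReal_mul_I_re, mul_comm]
      rcases abs_cases y with ⟨h, _⟩ | ⟨h, _⟩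
      · rw [h]
      · rw [h, hf, mul_neg, Real.cos_neg]
    simp only [h3] at h2
    linarith
  · refine hi.ofReal.bdd_mul (c := 1) (by fun_prop) (Eventually.of_forall fun u => ?_)
    rw [← Complex.ofReal_mul, Complex.norm_exp_ofReal_mul_I]

/-! ### Comparison of the averages -/

lemma sechKer_add_sechKer (a b : ℝ) : sechKer (a - b) + sechKer (a + b)
    = 2 * Real.cosh a * Real.cosh b / (Real.cosh (2 * a) + Real.cosh (2 * b)) := by
  have h1 := Real.cosh_pos (a - b)
  have h2 := Real.cosh_pos (a + b)
  have h3 : Real.cosh (2 * a) + Real.cosh (2 * b) = 2 * (Real.cosh (a - b) * Real.cosh (a + b)) := by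
    have e1 := Real.cosh_add (a - b) (a + b)
    have e2 := Real.cosh_sub (a + b) (a - b)
    rw [show (a - b) + (a + b) = 2 * a by ring] at e1
    rw [show (a + b) - (a - b) = 2 * b by ring] at e2
    rw [e1, e2]
    ring
  have h4 : 2 * Real.cosh a * Real.cosh b = Real.cosh (a - b) + Real.cosh (a + b) := by
    rw [Real.cosh_add, Real.cosh_sub]; ring
  rw [h3, h4, sechKer, sechKer]
  field_simp
  ring

lemma stepKer_sub_stepKer (a b : ℝ) : stepKer (a - b) - stepKer (a + b)
    = Real.sinh (2 * b) / (Real.cosh (2 * a) + Real.cosh (2 * b)) := by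
  have h1 := Real.cosh_pos (2 * a)
  have h2 := Real.cosh_pos (2 * b)
  rw [stepKer, stepKer, div_sub_div _ _ (by positivity) (by positivity), div_eq_div_iff
    (by positivity) (by positivity), Real.cosh_eq, Real.cosh_eq, Real.sinh_eq, mul_sub 2 a b,
    mul_add 2 a b, Real.exp_sub, Real.exp_add, Real.exp_neg, Real.exp_neg]
  field_simp
  ring

lemma sechAvg_symm (y : ℝ) : sechAvg y = ∫ u, dens u *
    ((sechKer (2 * Real.pi * y - 2 * Real.pi * u) + sechKer (2 * Real.pi * y + 2 * Real.pi * u)) / 2) := by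
  have h1 : sechAvg y = ∫ u, dens u * sechKer (2 * Real.pi * (y - -u)) := by
    rw [sechAvg, ← integral_dens_comp_neg]
  have hi : Integrable fun u => dens u * sechKer (2 * Real.pi * (y - -u)) :=
    integrable_dens_mul (continuous_sechKer.comp (by fun_prop)) fun _ => abs_sechKer_le _
  have h2 := integral_add (integrable_dens_sech y) hi
  rw [← h1, ← sechAvg] at h2
  have h3 : sechAvg y = (sechAvg y + sechAvg y) / 2 := by ring
  rw [h3, ← h2, ← integral_div]
  congr 1 with u
  rw [← mul_sub, ← mul_add, sub_neg_eq_add]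
  ring_nf

/-- After averaging over u and -u the comparison is pointwise: with A = cosh(2πy) and B = cosh(2πu)
it reads A² + B² - 1 ≤ A²B², that is (A² - 1)(B² - 1) ≥ 0. -/
lemma sechAvg_zero_div_cosh_le (y : ℝ) : sechAvg 0 / Real.cosh (2 * Real.pi * y) ≤ sechAvg y := by
  rw [sechAvg_symm y, sechAvg, ← integral_div]
  refine integral_mono ((integrable_dens_sech 0).div_const _) ?_ fun u => ?_
  · exact integrable_dens_mul (c := 1) (g := fun u => (sechKer (2 * Real.pi * y - 2 * Real.pi * u) +
      sechKer (2 * Real.pi * y + 2 * Real.pi * u)) / 2)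
      (((continuous_sechKer.comp (by fun_prop)).add (continuous_sechKer.comp (by fun_prop))).div_const _)
      fun u => by
        have h1 := sechKer_pos (2 * Real.pi * y - 2 * Real.pi * u)
        have h2 := sechKer_pos (2 * Real.pi * y + 2 * Real.pi * u)
        have h3 := sechKer_le_one (2 * Real.pi * y - 2 * Real.pi * u)
        have h4 := sechKer_le_one (2 * Real.pi * y + 2 * Real.pi * u)
        rw [abs_of_nonneg (by linarith)]
        linarith
  · dsimp only
    rw [mul_div_assoc]
    refine mul_le_mul_of_nonneg_left ?_ (dens_nonneg u)
    rw [zero_sub, mul_neg, sechKer_neg, sechKer_add_sechKer, sechKer, Real.cosh_two_mul, Real.cosh_two_mul,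
      Real.sinh_sq, Real.sinh_sq]
    have ha := Real.one_le_cosh (2 * Real.pi * y)
    have hb := Real.one_le_cosh (2 * Real.pi * u)
    set A := Real.cosh (2 * Real.pi * y)
    set B := Real.cosh (2 * Real.pi * u)
    have hA : 1 ≤ A ^ 2 := one_le_pow₀ ha
    have hB : 1 ≤ B ^ 2 := one_le_pow₀ hb
    have hd : 0 < A ^ 2 + (A ^ 2 - 1) + (B ^ 2 + (B ^ 2 - 1)) := by linarith
    rw [div_div, div_div, div_le_div_iff₀ (by positivity) (by positivity)]
    nlinarith [mul_nonneg (sub_nonneg.2 hA) (sub_nonneg.2 hB)]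

lemma integral_sech_sq_scaled {c : ℝ} (hc : 0 < c) :
    ∫ y : ℝ, 1 / (2 * Real.cosh (c * y)) ^ 2 = 1 / (2 * c) := by
  have h := integral_exp_mul_cosh_rpow (b := 1) (by norm_num) 0
  simp only [cosh_rpow_neg_two] at h
  rw [show (2 * ((1 : ℝ) : ℂ)) = ((1 : ℕ) : ℂ) + 1 by push_cast; ring, Complex.Gamma_nat_eq_factorial] at h
  simp only [Complex.ofReal_zero, zero_mul, Complex.exp_zero, one_mul, integral_complex_ofReal, add_zero,
    sub_zero, Complex.ofReal_one, Complex.Gamma_one, Nat.factorial_one, Nat.cast_one, div_one] at h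
  have h' : ∫ v : ℝ, 1 / (2 * Real.cosh (v / 2)) ^ 2 = 1 := by exact_mod_cast h
  have h2 := Measure.integral_comp_mul_left (fun v : ℝ => 1 / (2 * Real.cosh (v / 2)) ^ 2) (2 * c)
  rw [h', abs_of_pos (by positivity), smul_eq_mul, mul_one, ← one_div] at h2
  rw [← h2]
  congr 1 with y
  congr 4
  ring

/-- Since sech is its own Fourier transform up to scaling, Fubini gives 4π V(0) = ∫ leg(t)/(2
cosh(t/4)) dt. The bound `one_div_cosh_le_leg` makes this at least ∫ dt/(2 cosh²(t/4)) = 4. -/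
lemma one_div_pi_le_sechAvg_zero : 1 / Real.pi ≤ sechAvg 0 := by
  have hp := Real.pi_pos
  have hs : Integrable fun t : ℝ => 1 / (2 * Real.cosh (1 / 4 * t)) := integrable_sech_scaled (by norm_num)
  have h1 : ((4 * Real.pi * sechAvg 0 : ℝ) : ℂ) = ∫ u : ℝ, ∫ t : ℝ,
      Complex.exp (t * u * Complex.I) * dens u * ((1 / (2 * Real.cosh (1 / 4 * t)) : ℝ) : ℂ) := by
    rw [sechAvg, ← integral_const_mul, ← integral_complex_ofReal]
    congr 1 with u
    have := integral_exp_mul_sech_scaled (c := 1 / 4) (by norm_num) u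
    have e : ∀ t : ℝ, Complex.exp (t * u * Complex.I) * dens u * ((1 / (2 * Real.cosh (1 / 4 * t)) : ℝ) : ℂ)
        = dens u * (Complex.exp (u * t * Complex.I) * ((1 / (2 * Real.cosh (1 / 4 * t)) : ℝ) : ℂ)) := by
      intro t
      rw [mul_comm (t : ℂ) u]
      ring
    simp only [e]
    rw [integral_const_mul, this, ← Complex.ofReal_mul]
    congr 1
    have hc := Real.cosh_pos (2 * Real.pi * u)
    rw [zero_sub, mul_neg, sechKer_neg, sechKer, show Real.pi * u / (2 * (1 / 4)) = 2 * Real.pi * u by ring]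
    field_simp
  have h2 : ∫ u : ℝ, ∫ t : ℝ,
      Complex.exp (t * u * Complex.I) * dens u * ((1 / (2 * Real.cosh (1 / 4 * t)) : ℝ) : ℂ)
      = ((∫ t : ℝ, leg t * (1 / (2 * Real.cosh (1 / 4 * t))) : ℝ) : ℂ) := by
    rw [integral_integral_swap]
    · rw [← integral_complex_ofReal]
      congr 1 with t
      rw [integral_mul_const, integral_exp_mul_dens]
      push_cast
      ring
    · have hi : Integrable (fun p : ℝ × ℝ => (dens p.1 * (1 / (2 * Real.cosh (1 / 4 * p.2))) : ℝ))
          (volume.prod volume) := integrable_dens.mul_prod hs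
      refine (hi.ofReal.bdd_mul (c := 1) (f := fun p : ℝ × ℝ => Complex.exp (p.2 * p.1 * Complex.I))
        (by fun_prop) (Eventually.of_forall fun p => ?_)).congr (Eventually.of_forall fun p => ?_)
      · rw [← Complex.ofReal_mul, Complex.norm_exp_ofReal_mul_I]
      · simp only [Function.uncurry]
        change Complex.exp (p.2 * p.1 * Complex.I) *
          ((dens p.1 * (1 / (2 * Real.cosh (1 / 4 * p.2))) : ℝ) : ℂ) = _
        rw [Complex.ofReal_mul, mul_assoc (Complex.exp _)]
  have h3 : 4 * Real.pi * sechAvg 0 = ∫ t : ℝ, leg t * (1 / (2 * Real.cosh (1 / 4 * t))) := by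
    rw [h2] at h1
    exact_mod_cast h1
  have h4 : ∫ t : ℝ, 2 * (1 / (2 * Real.cosh (1 / 4 * t)) ^ 2) = 4 := by
    rw [integral_const_mul, integral_sech_sq_scaled (by norm_num)]
    norm_num
  have h5 : ∫ t : ℝ, 2 * (1 / (2 * Real.cosh (1 / 4 * t)) ^ 2)
      ≤ ∫ t : ℝ, leg t * (1 / (2 * Real.cosh (1 / 4 * t))) := by
    refine integral_mono ((integrable_sech_sq_scaled (by norm_num)).const_mul 2) ?_ fun t => ?_
    · refine hs.bdd_mul (c := 1) continuous_leg.aestronglyMeasurable (Eventually.of_forall fun t => ?_)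
      rw [Real.norm_of_nonneg (leg_nonneg t), ← integral_dens_mul_cos, ← integral_dens]
      refine integral_mono (integrable_dens_mul (c := 1) (by fun_prop) fun u => Real.abs_cos_le_one _)
        integrable_dens fun u => mul_le_of_le_one_right (dens_nonneg u) (Real.cos_le_one _)
    · have hc := Real.cosh_pos (1 / 4 * t)
      have h := one_div_cosh_le_leg t
      rw [show t / 4 = 1 / 4 * t by ring] at h
      calc 2 * (1 / (2 * Real.cosh (1 / 4 * t)) ^ 2)
          = 1 / Real.cosh (1 / 4 * t) * (1 / (2 * Real.cosh (1 / 4 * t))) := by field_simp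
        _ ≤ _ := mul_le_mul_of_nonneg_right h (by positivity)
  rw [div_le_iff₀ hp]
  linarith

lemma mul_exp_neg_le (x : ℝ) : x * Real.exp (-x) ≤ 1 / 2 := by
  rw [Real.exp_neg, ← div_eq_mul_inv, div_le_div_iff₀ (Real.exp_pos x) (by norm_num)]
  have h1 := Real.add_one_le_exp (x / 2)
  have h2 : Real.exp x = Real.exp (x / 2) * Real.exp (x / 2) := by rw [← Real.exp_add]; ring_nf
  rcases le_total x 0 with h | h
  · linarith [Real.exp_pos x]
  · rw [h2]
    nlinarith [sq_nonneg (x / 2 - 1)]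

lemma integrable_dens_mul_id_step (y : ℝ) :
    Integrable fun u => dens u * (u * stepKer (2 * Real.pi * (y - u))) := by
  have hp := Real.pi_pos
  refine ((integrable_sechKer_scaled (c := 2 * Real.pi) (by positivity)).const_mul 2).mono'
    (continuous_dens.mul (continuous_id.mul (continuous_stepKer.comp (by fun_prop)))).aestronglyMeasurable
    (Eventually.of_forall fun u => ?_)
  have hc := Real.cosh_pos (2 * Real.pi * u)
  have h := abs_mul_dens_mul_cosh_le u
  rw [norm_mul, Real.norm_of_nonneg (dens_nonneg u), norm_mul, Real.norm_eq_abs, Real.norm_eq_abs, sechKer]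
  have h2 : |u| * dens u ≤ 2 * (1 / (2 * Real.cosh (2 * Real.pi * u))) := by
    rw [show 2 * (1 / (2 * Real.cosh (2 * Real.pi * u))) = 1 / Real.cosh (2 * Real.pi * u) by field_simp,
      le_div_iff₀ hc]
    exact h
  calc dens u * (|u| * |stepKer (2 * Real.pi * (y - u))|) ≤ dens u * (|u| * 1) := by
        have := dens_nonneg u
        gcongr
        exact abs_stepKer_le _
    _ ≤ _ := by linarith

/-- Symmetrising in u, with a = 2πy and b = 2πu, replaces the step by sinh(2b)/(cosh(2a) +
cosh(2b)). One factor sinh b is absorbed by `abs_mul_dens_mul_cosh_le`; the rest is a sum of two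
shifted secants divided by cosh a, each secant of integral 1/4. -/
lemma integral_dens_mul_id_step_le (y : ℝ) :
    ∫ u, dens u * (u * stepKer (2 * Real.pi * (y - u))) ≤ 1 / (4 * Real.cosh (2 * Real.pi * y)) := by
  have hp := Real.pi_pos
  set J := ∫ u, dens u * (u * stepKer (2 * Real.pi * (y - u))) with hJ
  have h1 : J = ∫ u, dens u * (-u * stepKer (2 * Real.pi * (y - -u))) := by
    rw [hJ, ← integral_dens_comp_neg]
  have hi : Integrable fun u => dens u * (-u * stepKer (2 * Real.pi * (y - -u))) := by
    have := (integrable_dens_mul_id_step y).comp_neg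
    simpa only [dens_neg] using this
  have h2 := integral_add (integrable_dens_mul_id_step y) hi
  rw [← h1, ← hJ] at h2
  have ha := Real.cosh_pos (2 * Real.pi * y)
  have hs1 := (integrable_sechKer_scaled (c := 2 * Real.pi) (by positivity)).comp_sub_left y
  have hs2 := (integrable_sechKer_scaled (c := 2 * Real.pi) (by positivity)).comp_add_left y
  have hi1 : ∫ u, sechKer (2 * Real.pi * u) = 1 / 4 := by
    have := integral_sech_scaled (c := 2 * Real.pi) (by positivity)
    refine this.trans ?_
    field_simp; norm_num
  have h3 : ∫ u, (dens u * (u * stepKer (2 * Real.pi * (y - u))) + dens u * (-u * stepKer (2 * Real.pi * (y - -u))))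
      ≤ ∫ u, 1 / Real.cosh (2 * Real.pi * y) *
        (sechKer (2 * Real.pi * (y - u)) + sechKer (2 * Real.pi * (y + u))) := by
    refine integral_mono ((integrable_dens_mul_id_step y).add hi) ((hs1.add hs2).const_mul _) fun u => ?_
    dsimp only
    rw [sub_neg_eq_add, mul_sub, mul_add, sechKer_add_sechKer]
    set a := 2 * Real.pi * y
    set b := 2 * Real.pi * u with hb
    have e : dens u * (u * stepKer (a - b)) + dens u * (-u * stepKer (a + b))
        = dens u * u * (stepKer (a - b) - stepKer (a + b)) := by ring
    rw [e, stepKer_sub_stepKer, Real.sinh_two_mul]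
    have hd : 0 < Real.cosh (2 * a) + Real.cosh (2 * b) :=
      add_pos (Real.cosh_pos _) (Real.cosh_pos _)
    have hbc := Real.cosh_pos b
    have h := abs_mul_dens_mul_cosh_le u
    rw [← hb] at h
    have h4 : dens u * u * Real.sinh b ≤ 1 := by
      refine le_trans ?_ h
      have h5 : u * Real.sinh b ≤ |u| * Real.cosh b := by
        refine (le_abs_self _).trans ?_
        rw [abs_mul, Real.abs_sinh]
        refine mul_le_mul_of_nonneg_left ?_ (abs_nonneg u)
        rw [← Real.cosh_abs b]
        exact (Real.sinh_lt_cosh _).le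
      nlinarith [dens_nonneg u]
    have e2 : 1 / Real.cosh a * (2 * Real.cosh a * Real.cosh b / (Real.cosh (2 * a) + Real.cosh (2 * b)))
        = 2 * Real.cosh b / (Real.cosh (2 * a) + Real.cosh (2 * b)) := by field_simp
    rw [e2, ← mul_div_assoc]
    refine div_le_div_of_nonneg_right ?_ hd.le
    nlinarith
  rw [h2, integral_const_mul, integral_add hs1 hs2,
    integral_sub_left_eq_self (fun u => sechKer (2 * Real.pi * u)) volume y,
    integral_add_left_eq_self (fun u => sechKer (2 * Real.pi * u)) y, hi1] at h3
  have : 1 / (4 * Real.cosh (2 * Real.pi * y)) = (1 / Real.cosh (2 * Real.pi * y) * (1 / 4 + 1 / 4)) / 2 := by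
    field_simp; norm_num
  rw [this]
  linarith

/-- Write y = (y - u) + u under the integral. The first part is at most V/(4π), because the step is
e^{-x} times the secant and x e^{-x} ≤ 1/2. The second is at most 1/(4 cosh(2πy)), hence at most
πV/4 by the lower bound for V. -/
lemma mul_stepAvg_lt_sechAvg (y : ℝ) : y * stepAvg y < sechAvg y := by
  have hp := Real.pi_pos
  have hV := sechAvg_pos y
  have ha := Real.cosh_pos (2 * Real.pi * y)
  have h1 : y * stepAvg y ≤ 1 / (4 * Real.pi) * sechAvg y
      + ∫ u, dens u * (u * stepKer (2 * Real.pi * (y - u))) := by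
    rw [stepAvg, sechAvg, ← integral_const_mul, ← integral_const_mul,
      ← integral_add ((integrable_dens_sech y).const_mul _) (integrable_dens_mul_id_step y)]
    refine integral_mono ((integrable_dens_step y).const_mul y)
      (((integrable_dens_sech y).const_mul _).add (integrable_dens_mul_id_step y)) fun u => ?_
    dsimp only
    set x := 2 * Real.pi * (y - u) with hx
    have h2 : (y - u) * stepKer x ≤ 1 / (4 * Real.pi) * sechKer x := by
      have h3 : y - u = x / (2 * Real.pi) := by rw [hx]; field_simp
      rw [stepKer_eq, h3]
      have h4 := mul_le_mul_of_nonneg_right (mul_exp_neg_le x) (sechKer_pos x).le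
      calc x / (2 * Real.pi) * (Real.exp (-x) * sechKer x)
          = (x * Real.exp (-x) * sechKer x) / (2 * Real.pi) := by ring
        _ ≤ (1 / 2 * sechKer x) / (2 * Real.pi) := by gcongr
        _ = _ := by field_simp; ring
    have h5 := mul_le_mul_of_nonneg_left h2 (dens_nonneg u)
    linarith
  have h6 := integral_dens_mul_id_step_le y
  have h7 : 1 / Real.pi / Real.cosh (2 * Real.pi * y) ≤ sechAvg y :=
    (div_le_div_of_nonneg_right one_div_pi_le_sechAvg_zero ha.le).trans (sechAvg_zero_div_cosh_le y)
  have h8 : 1 / (4 * Real.cosh (2 * Real.pi * y)) ≤ Real.pi / 4 * sechAvg y := by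
    calc _ = Real.pi / 4 * (1 / Real.pi / Real.cosh (2 * Real.pi * y)) := by field_simp
      _ ≤ _ := by gcongr
  -- The two shares of V add up to about 0.87.
  have h9 : 1 / (4 * Real.pi) + Real.pi / 4 < 1 := by
    have := Real.pi_gt_three
    have := Real.pi_lt_four
    have : Real.pi < 3.15 := Real.pi_lt_d2
    rw [div_add_div _ _ (by positivity) (by norm_num), div_lt_one (by positivity)]
    nlinarith
  nlinarith


/-! ### The integral representation of the remainder -/

lemma integrableOn_pow_mul_exp_neg (k : ℕ) {b : ℝ} (hb : 0 < b) :
    IntegrableOn (fun y : ℝ => y ^ k * Real.exp (-b * y)) (Ioi 0) := by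
  have h := integrableOn_rpow_mul_exp_neg_mul_rpow (s := k) (p := 1) (b := b)
    (by linarith [(k.cast_nonneg : (0 : ℝ) ≤ k)]) one_pos hb
  refine h.congr_fun (fun y _ => ?_) measurableSet_Ioi
  simp only [Real.rpow_natCast, Real.rpow_one]

lemma integrableOn_pow_mul_of_le_exp {f : ℝ → ℝ} (hf : Continuous f) (h0 : ∀ y, 0 ≤ f y) {M b : ℝ}
    (hb : 0 < b) (h : ∀ y, f y ≤ M * Real.exp (-b * y)) (k : ℕ) :
    IntegrableOn (fun y => y ^ k * f y) (Ioi 0) := by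
  refine ((integrableOn_pow_mul_exp_neg k hb).const_mul M).mono'
    ((continuous_id.pow k).mul hf).aestronglyMeasurable ?_
  refine (ae_restrict_iff' measurableSet_Ioi).2 (Eventually.of_forall fun y hy => ?_)
  have hy' : 0 < y := hy
  rw [Real.norm_of_nonneg (mul_nonneg (by positivity) (h0 y))]
  have := mul_le_mul_of_nonneg_left (h y) (pow_nonneg hy'.le k)
  linarith

lemma integrableOn_pow_mul_sechAvg (k : ℕ) : IntegrableOn (fun y => y ^ k * sechAvg y) (Ioi 0) :=
  integrableOn_pow_mul_of_le_exp continuous_sechAvg (fun y => (sechAvg_pos y).le) Real.pi_pos sechAvg_le_exp k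

lemma integrableOn_pow_mul_stepAvg (k : ℕ) : IntegrableOn (fun y => y ^ k * stepAvg y) (Ioi 0) :=
  integrableOn_pow_mul_of_le_exp continuous_stepAvg (fun y => (stepAvg_pos y).le) Real.pi_pos stepAvg_le_exp k

lemma integrableOn_sechAvg : IntegrableOn sechAvg (Ioi 0) := by
  simpa using integrableOn_pow_mul_sechAvg 0

lemma integrableOn_stepAvg : IntegrableOn stepAvg (Ioi 0) := by
  simpa using integrableOn_pow_mul_stepAvg 0

lemma integrable_of_even {f : ℝ → ℝ} (hf : ∀ y, f (-y) = f y)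
    (hi : IntegrableOn f (Ioi 0)) : Integrable f := by
  rw [← integrableOn_univ, ← Iic_union_Ioi (a := (0 : ℝ))]
  refine IntegrableOn.union ?_ hi
  have h := (integrable_indicator_iff measurableSet_Ioi).2 hi |>.comp_neg
  have h2 : IntegrableOn f (Iio 0) := by
    rw [← integrable_indicator_iff measurableSet_Iio]
    refine h.congr (Eventually.of_forall fun y => ?_)
    by_cases hy : y < 0 <;> simp [hy, hf]
  rwa [integrableOn_Iic_iff_integrableOn_Iio]

lemma integrable_sechAvg : Integrable sechAvg :=
  integrable_of_even sechAvg_neg integrableOn_sechAvg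

lemma sqAvg_neg (y : ℝ) : sqAvg (-y) = sqAvg y := by
  rw [sqAvg, sqAvg, ← integral_dens_comp_neg]
  congr 1 with u
  rw [← sechKer_neg]
  ring_nf

lemma integrable_sqAvg : Integrable sqAvg :=
  integrable_sechAvg.mono' continuous_sqAvg.aestronglyMeasurable (Eventually.of_forall fun y => by
    rw [Real.norm_of_nonneg (sqAvg_nonneg y)]
    exact sqAvg_le_sechAvg y)

lemma integral_sechAvg_mul_cos (t : ℝ) :
    ∫ y in Ioi (0 : ℝ), sechAvg y * Real.cos (t * y) = leg t / (8 * Real.cosh (t / 4)) := by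
  rw [integral_Ioi_mul_cos_of_even sechAvg_neg integrable_sechAvg (integral_exp_mul_sechAvg t)]
  have := Real.cosh_pos (t / 4)
  field_simp
  ring

lemma tendsto_stepAvg : Tendsto stepAvg atTop (𝓝 0) := by
  have h : Tendsto (fun y => (∫ u, dens u * Real.exp (Real.pi * u)) * Real.exp (-Real.pi * y)) atTop (𝓝 0) := by
    have h1 : Tendsto (fun y => Real.exp (-Real.pi * y)) atTop (𝓝 0) :=
      Real.tendsto_exp_atBot.comp (tendsto_id.const_mul_atTop_of_neg (neg_lt_zero.2 Real.pi_pos))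
    simpa using h1.const_mul (∫ u, dens u * Real.exp (Real.pi * u))
  exact squeeze_zero (fun y => (stepAvg_pos y).le) stepAvg_le_exp h

/-- Integration by parts: the boundary value S(0) = 1/2 produces 1/(2t), and the derivative of S
produces the sech² transform with 1/sinh(t/4). -/
lemma integral_stepAvg_mul_sin {t : ℝ} (ht : 0 < t) :
    ∫ y in Ioi (0 : ℝ), stepAvg y * Real.sin (t * y) = 1 / (2 * t) - leg t / (8 * Real.sinh (t / 4)) := by
  have hp := Real.pi_pos
  have hs : 0 < Real.sinh (t / 4) := Real.sinh_pos_iff.2 (by positivity)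
  have hcos := integral_Ioi_mul_cos_of_even sqAvg_neg integrable_sqAvg (integral_exp_mul_sqAvg ht.ne')
  have hv : ∀ y : ℝ, HasDerivAt (fun y => -Real.cos (t * y) / t) (Real.sin (t * y)) y := by
    intro y
    have h1 : HasDerivAt (fun y => t * y) t y := by simpa using (hasDerivAt_id y).const_mul t
    have h2 := (((Real.hasDerivAt_cos (t * y)).comp y h1).neg).div_const t
    refine h2.congr_deriv ?_
    field_simp
  have hcb2 : ∀ y : ℝ, |-Real.cos (t * y) / t| ≤ 1 / t := fun y => by
    rw [abs_div, abs_neg, abs_of_pos ht]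
    exact div_le_div_of_nonneg_right (Real.abs_cos_le_one _) ht.le
  have h := integral_Ioi_mul_deriv_eq_deriv_mul (a := 0) (a' := -(1 / (2 * t))) (b' := 0)
    (u := stepAvg) (u' := fun y => -(4 * Real.pi) * sqAvg y)
    (v := fun y => -Real.cos (t * y) / t) (v' := fun y => Real.sin (t * y))
    (fun y _ => hasDerivAt_stepAvg y) (fun y _ => hv y)
    (integrableOn_stepAvg.mul_bdd (c := 1) (Continuous.aestronglyMeasurable (by fun_prop))
      (Eventually.of_forall fun y => Real.abs_sin_le_one _))
    ((integrable_sqAvg.integrableOn.const_mul _).mul_bdd (c := 1 / t)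
      (Continuous.aestronglyMeasurable (by fun_prop)) (Eventually.of_forall hcb2)) ?_ ?_
  · rw [h]
    have e : ∀ y : ℝ, -(4 * Real.pi) * sqAvg y * (-Real.cos (t * y) / t)
        = (4 * Real.pi / t) * (sqAvg y * Real.cos (t * y)) := by
      intro y; field_simp
    simp only [e]
    rw [integral_const_mul, hcos]
    field_simp
    ring
  · have hc : Continuous (stepAvg * fun y => -Real.cos (t * y) / t) :=
      continuous_stepAvg.mul (by fun_prop)
    have := (hc.tendsto 0).mono_left (nhdsWithin_le_nhds (s := Ioi 0))
    convert! this using 2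
    simp only [Pi.mul_apply, stepAvg_zero, mul_zero, Real.cos_zero]
    field_simp
  · have := bdd_le_mul_tendsto_zero' (1 / t) (Eventually.of_forall hcb2) tendsto_stepAvg
    exact this.congr fun y => mul_comm _ _

lemma integral_exp_neg_mul_cexp {x : ℝ} (hx : 0 < x) (y : ℝ) :
    ∫ t in Ioi (0 : ℝ), Complex.exp ((-x + y * Complex.I) * t) = (x + y * Complex.I) / ((x ^ 2 + y ^ 2 : ℝ) : ℂ) := by
  rw [integral_exp_mul_complex_Ioi (by simpa using hx)]
  have h1 : (-x + y * Complex.I : ℂ) ≠ 0 := fun h => by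
    have := congrArg Complex.re h
    simp at this
    linarith
  have h2 : (((x ^ 2 + y ^ 2 : ℝ)) : ℂ) ≠ 0 := by exact_mod_cast (by positivity : x ^ 2 + y ^ 2 ≠ 0)
  rw [div_eq_div_iff h1 h2]
  simp only [Complex.ofReal_zero, mul_zero, Complex.exp_zero]
  push_cast
  linear_combination (-y ^ 2 : ℂ) * Complex.I_sq

lemma exp_eq_cos_sin (x y t : ℝ) : Complex.exp ((-x + y * Complex.I) * t)
    = (Real.exp (-x * t) * Real.cos (t * y) : ℝ) + (Real.exp (-x * t) * Real.sin (t * y) : ℝ) * Complex.I := by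
  rw [show (-x + y * Complex.I : ℂ) * t = ((-x * t : ℝ) : ℂ) + ((t * y : ℝ) : ℂ) * Complex.I by
    push_cast; ring, Complex.exp_add, Complex.exp_mul_I]
  push_cast
  ring

lemma integral_exp_mul_cos {x : ℝ} (hx : 0 < x) (y : ℝ) :
    ∫ t in Ioi (0 : ℝ), Real.exp (-x * t) * Real.cos (t * y) = x / (x ^ 2 + y ^ 2) := by
  have h := congrArg Complex.re (integral_exp_neg_mul_cexp hx y)
  have hi := integrableOn_exp_mul_complex_Ioi (a := (-x + y * Complex.I)) (by simpa using hx) 0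
  rw [← RCLike.re_eq_complex_re, ← integral_re hi, RCLike.re_eq_complex_re, Complex.div_ofReal_re] at h
  simp only [exp_eq_cos_sin, Complex.add_re, Complex.re_ofReal_mul,
    Complex.ofReal_re, Complex.I_re, mul_zero, add_zero] at h
  exact h

lemma integral_exp_mul_sin {x : ℝ} (hx : 0 < x) (y : ℝ) :
    ∫ t in Ioi (0 : ℝ), Real.exp (-x * t) * Real.sin (t * y) = y / (x ^ 2 + y ^ 2) := by
  have h := congrArg Complex.im (integral_exp_neg_mul_cexp hx y)
  have hi := integrableOn_exp_mul_complex_Ioi (a := (-x + y * Complex.I)) (by simpa using hx) 0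
  rw [← RCLike.im_eq_complex_im, ← integral_im hi, RCLike.im_eq_complex_im, Complex.div_ofReal_im] at h
  simp only [exp_eq_cos_sin, Complex.add_im, Complex.im_ofReal_mul,
    Complex.ofReal_im, Complex.I_im, mul_one, zero_add] at h
  exact h

/-- The function represented by the asymptotic series. -/
noncomputable def tailInt (x : ℝ) : ℝ :=
  -2 * ∫ y in Ioi (0 : ℝ), (x * sechAvg y - y * stepAvg y) / (x ^ 2 + y ^ 2)

/-- The inverse Laplace transform of `tailInt`. -/
noncomputable def borel (t : ℝ) : ℝ :=
  1 / t - leg t / 4 * (1 / Real.cosh (t / 4) + 1 / Real.sinh (t / 4))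

lemma integrable_exp_mul_averages {x : ℝ} (hx : 0 < x) :
    Integrable (fun p : ℝ × ℝ => Real.exp (-x * p.2) *
      (sechAvg p.1 * Real.cos (p.2 * p.1) - stepAvg p.1 * Real.sin (p.2 * p.1)))
      ((volume.restrict (Ioi 0)).prod (volume.restrict (Ioi 0))) := by
  have h1 := (integrableOn_sechAvg.add integrableOn_stepAvg).mul_prod (exp_neg_integrableOn_Ioi 0 hx)
  have hc : Continuous (fun p : ℝ × ℝ => Real.exp (-x * p.2) *
      (sechAvg p.1 * Real.cos (p.2 * p.1) - stepAvg p.1 * Real.sin (p.2 * p.1))) := by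
    have h1 : Continuous fun p : ℝ × ℝ => sechAvg p.1 := continuous_sechAvg.comp continuous_fst
    have h2 : Continuous fun p : ℝ × ℝ => stepAvg p.1 := continuous_stepAvg.comp continuous_fst
    fun_prop
  refine h1.mono' hc.aestronglyMeasurable (Eventually.of_forall fun p => ?_)
  rw [norm_mul, Real.norm_of_nonneg (Real.exp_pos _).le, mul_comm]
  refine mul_le_mul_of_nonneg_right ?_ (Real.exp_pos _).le
  refine (norm_sub_le _ _).trans ?_
  rw [norm_mul, norm_mul, Real.norm_of_nonneg (sechAvg_pos p.1).le, Real.norm_of_nonneg (stepAvg_pos p.1).le]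
  exact add_le_add (mul_le_of_le_one_right (sechAvg_pos p.1).le (Real.abs_cos_le_one _))
    (mul_le_of_le_one_right (stepAvg_pos p.1).le (Real.abs_sin_le_one _))

lemma integral_averages_eq_borel {x t : ℝ} (ht : 0 < t) :
    ∫ y in Ioi (0 : ℝ), Real.exp (-x * t) * (sechAvg y * Real.cos (t * y) - stepAvg y * Real.sin (t * y))
      = Real.exp (-x * t) * borel t / (-2) := by
  have hs : 0 < Real.sinh (t / 4) := Real.sinh_pos_iff.2 (by positivity)
  have hc := Real.cosh_pos (t / 4)
  rw [integral_const_mul, integral_sub, integral_sechAvg_mul_cos, integral_stepAvg_mul_sin ht, borel]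
  · field_simp
    ring
  · exact integrableOn_sechAvg.mul_bdd (c := 1) (Continuous.aestronglyMeasurable (by fun_prop))
      (Eventually.of_forall fun y => Real.abs_cos_le_one _)
  · exact integrableOn_stepAvg.mul_bdd (c := 1) (Continuous.aestronglyMeasurable (by fun_prop))
      (Eventually.of_forall fun y => Real.abs_sin_le_one _)

lemma integrableOn_exp_mul_borel {x : ℝ} (hx : 0 < x) :
    IntegrableOn (fun t => Real.exp (-x * t) * borel t) (Ioi 0) := by
  have h := (integrable_exp_mul_averages hx).integral_prod_right
  have h2 : IntegrableOn (fun t => Real.exp (-x * t) * borel t / (-2)) (Ioi 0) :=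
    IntegrableOn.congr_fun h (fun t ht => integral_averages_eq_borel ht) measurableSet_Ioi
  refine IntegrableOn.congr_fun (h2.mul_const (-2)) (fun t _ => ?_) measurableSet_Ioi
  ring

/-- Fubini: x/(x² + y²) and y/(x² + y²) are the Laplace transforms in t of cos(ty) and sin(ty), and
the y-integrals of V cos and S sin assemble to `borel`. -/
lemma tailInt_eq_integral_borel {x : ℝ} (hx : 0 < x) :
    tailInt x = ∫ t in Ioi (0 : ℝ), Real.exp (-x * t) * borel t := by
  have h := integral_integral_swap (μ := volume.restrict (Ioi 0)) (ν := volume.restrict (Ioi 0))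
    (f := fun y t => Real.exp (-x * t) * (sechAvg y * Real.cos (t * y) - stepAvg y * Real.sin (t * y)))
    (integrable_exp_mul_averages hx)
  have h1 : ∫ t in Ioi (0 : ℝ), ∫ y in Ioi (0 : ℝ),
      Real.exp (-x * t) * (sechAvg y * Real.cos (t * y) - stepAvg y * Real.sin (t * y))
      = (∫ t in Ioi (0 : ℝ), Real.exp (-x * t) * borel t) / (-2) := by
    rw [← integral_div]
    exact setIntegral_congr_fun measurableSet_Ioi fun t ht => integral_averages_eq_borel ht
  have h2 : ∀ y : ℝ, ∫ t in Ioi (0 : ℝ),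
      Real.exp (-x * t) * (sechAvg y * Real.cos (t * y) - stepAvg y * Real.sin (t * y))
      = (x * sechAvg y - y * stepAvg y) / (x ^ 2 + y ^ 2) := by
    intro y
    have e : ∀ t : ℝ, Real.exp (-x * t) * (sechAvg y * Real.cos (t * y) - stepAvg y * Real.sin (t * y))
        = sechAvg y * (Real.exp (-x * t) * Real.cos (t * y)) - stepAvg y * (Real.exp (-x * t) * Real.sin (t * y)) := by
      intro t; ring
    simp only [e]
    rw [integral_sub, integral_const_mul, integral_const_mul, integral_exp_mul_cos hx,
      integral_exp_mul_sin hx]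
    · ring
    · exact ((exp_neg_integrableOn_Ioi 0 hx).mul_bdd (c := 1) (Continuous.aestronglyMeasurable (by fun_prop))
        (Eventually.of_forall fun t => Real.abs_cos_le_one _)).const_mul _
    · exact ((exp_neg_integrableOn_Ioi 0 hx).mul_bdd (c := 1) (Continuous.aestronglyMeasurable (by fun_prop))
        (Eventually.of_forall fun t => Real.abs_sin_le_one _)).const_mul _
  simp only [h2] at h
  rw [tailInt, h, h1]
  ring

lemma integrableOn_exp_sub_exp_div {x : ℝ} (hx : 0 < x) :
    IntegrableOn (fun t => t⁻¹ • (Real.exp (-(x * t)) - Real.exp (-((x + 1) * t)))) (Ioi 0) := by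
  refine (exp_neg_integrableOn_Ioi 0 hx).mono' ?_ ?_
  · refine ContinuousOn.aestronglyMeasurable (fun t ht => ?_) measurableSet_Ioi
    have ht' : t ≠ 0 := (mem_Ioi.1 ht).ne'
    exact ContinuousAt.continuousWithinAt (by fun_prop (disch := exact ht'))
  · refine (ae_restrict_iff' measurableSet_Ioi).2 (Eventually.of_forall fun t ht => ?_)
    have ht' : 0 < t := ht
    have h1 : Real.exp (-((x + 1) * t)) = Real.exp (-x * t) * Real.exp (-t) := by
      rw [← Real.exp_add]; ring_nf
    have h2 : 0 ≤ 1 - Real.exp (-t) := sub_nonneg.2 (Real.exp_le_one_iff.2 (by linarith))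
    have h3 : 1 - Real.exp (-t) ≤ t := by linarith [Real.add_one_le_exp (-t)]
    have h4 := Real.exp_pos (-x * t)
    rw [h1, ← neg_mul, smul_eq_mul, Real.norm_of_nonneg]
    · calc t⁻¹ * (Real.exp (-x * t) - Real.exp (-x * t) * Real.exp (-t))
          = Real.exp (-x * t) * ((1 - Real.exp (-t)) / t) := by field_simp
        _ ≤ Real.exp (-x * t) * 1 := by
          gcongr
          exact (div_le_one ht').2 h3
        _ = _ := mul_one _
    · have : 0 ≤ Real.exp (-x * t) * (1 - Real.exp (-t)) := mul_nonneg h4.le h2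
      exact mul_nonneg (by positivity) (by linarith)

lemma integral_exp_sub_exp_div {x : ℝ} (hx : 0 < x) :
    ∫ t in Ioi (0 : ℝ), t⁻¹ • (Real.exp (-(x * t)) - Real.exp (-((x + 1) * t))) = Real.log ((x + 1) / x) := by
  have hc : Continuous fun s : ℝ => Real.exp (-s) := by fun_prop
  have h := Frullani.integral_Ioi_eq (f := fun s : ℝ => Real.exp (-s)) (a := x) (b := x + 1) (L := 1) (R := 0)
    (hc.locallyIntegrable.locallyIntegrableOn _) hx (by linarith)
    (by simpa using (hc.tendsto 0).mono_left (nhdsWithin_le_nhds (s := Ioi 0)))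
    (Real.tendsto_exp_atBot.comp tendsto_neg_atTop_atBot) (integrableOn_exp_sub_exp_div hx)
  simpa using h

/-- The factor 1 - e^{-t} produced by the shift undoes the geometric series in `borel`; the term 1/t
becomes a Frullani integral. -/
lemma tailInt_sub_tailInt {x : ℝ} (hx : 0 < x) : tailInt (x + 1) - tailInt x
    = (∫ t in Ioi (0 : ℝ), Real.exp (-(x + 1 / 4) * t) * leg t) - Real.log ((x + 1) / x) := by
  rw [tailInt_eq_integral_borel hx, tailInt_eq_integral_borel (by linarith : 0 < x + 1),
    ← integral_exp_sub_exp_div hx,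
    ← integral_sub (integrableOn_exp_mul_borel (by linarith)) (integrableOn_exp_mul_borel hx),
    ← integral_sub (integrableOn_exp_mul_leg_real (by linarith)) (integrableOn_exp_sub_exp_div hx)]
  refine setIntegral_congr_fun measurableSet_Ioi fun t ht => ?_
  have ht' : 0 < t := ht
  have hs : 0 < Real.sinh (t / 4) := Real.sinh_pos_iff.2 (by positivity)
  have hc := Real.cosh_pos (t / 4)
  have e1 : Real.exp (-(x + 1) * t) = Real.exp (-x * t) * Real.exp (-t) := by
    rw [← Real.exp_add]; ring_nf
  have e2 : Real.exp (-((x + 1) * t)) = Real.exp (-x * t) * Real.exp (-t) := by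
    rw [← Real.exp_add]; ring_nf
  have e3 : Real.exp (-(x + 1 / 4) * t) = Real.exp (-x * t) * Real.exp (-(t / 4)) := by
    rw [← Real.exp_add]; ring_nf
  have key : (1 - Real.exp (-t)) * (1 / Real.cosh (t / 4) + 1 / Real.sinh (t / 4)) = 4 * Real.exp (-(t / 4)) := by
    have e4 : Real.exp (-t) = Real.exp (-(t / 4)) ^ 4 := by
      rw [← Real.exp_nat_mul]; congr 1; push_cast; ring
    have e5 : Real.cosh (t / 4) + Real.sinh (t / 4) = Real.exp (t / 4) := Real.cosh_add_sinh _
    rw [e4, div_add_div _ _ hc.ne' hs.ne', one_mul, mul_one, add_comm (Real.sinh _), e5, ← mul_div_assoc,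
      div_eq_iff (by positivity), Real.cosh_eq, Real.sinh_eq, Real.exp_neg]
    field_simp
    ring
  rw [e1, e2, e3, smul_eq_mul, borel, ← neg_mul]
  linear_combination (Real.exp (-x * t) * leg t / 4) * key

/-- For x ≥ 1 the key inequality y S < V bounds the numerator by 2xV, so the integral is O(1/x). -/
lemma tendsto_tailInt : Tendsto tailInt atTop (𝓝 0) := by
  set I1 := ∫ y in Ioi (0 : ℝ), sechAvg y with hI1
  have hb : ∀ x : ℝ, 1 ≤ x → ‖tailInt x‖ ≤ 2 * (2 * I1) / x := by
    intro x hx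
    have hx0 : 0 < x := by linarith
    have h : ‖∫ y in Ioi (0 : ℝ), (x * sechAvg y - y * stepAvg y) / (x ^ 2 + y ^ 2)‖
        ≤ ∫ y in Ioi (0 : ℝ), 2 / x * sechAvg y := by
      refine norm_integral_le_of_norm_le (integrableOn_sechAvg.const_mul _) ?_
      refine (ae_restrict_iff' measurableSet_Ioi).2 (Eventually.of_forall fun y hy => ?_)
      have hy' : 0 < y := hy
      have h1 := sechAvg_pos y
      have h2 := stepAvg_pos y
      have h3 := mul_stepAvg_lt_sechAvg y
      rw [norm_div, Real.norm_of_nonneg (by positivity : 0 ≤ x ^ 2 + y ^ 2), div_le_iff₀ (by positivity)]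
      have h4 : ‖x * sechAvg y - y * stepAvg y‖ ≤ 2 * x * sechAvg y := by
        rw [Real.norm_eq_abs, abs_le]
        constructor <;> nlinarith [mul_pos hy' h2]
      refine h4.trans ?_
      have : 2 / x * sechAvg y * (x ^ 2 + y ^ 2) = 2 * x * sechAvg y + 2 / x * sechAvg y * y ^ 2 := by
        field_simp
      rw [this]
      have : 0 ≤ 2 / x * sechAvg y * y ^ 2 := by positivity
      linarith
    rw [integral_const_mul] at h
    rw [tailInt, norm_mul, norm_neg, Real.norm_ofNat]
    calc _ ≤ 2 * (2 / x * I1) := by gcongr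
      _ = _ := by ring
  refine squeeze_zero_norm' (eventually_atTop.2 ⟨1, hb⟩) ?_
  exact tendsto_const_nhds.div_atTop tendsto_id


/-! ### The constant term -/

/-- The Wallis ratio `(1·3⋯(2k-1)) / (2·4⋯(2k))`. -/
noncomputable def wallisRatio (k : ℕ) : ℝ :=
  ∏ j ∈ Finset.range k, (2 * (j : ℝ) + 1) / (2 * (j : ℝ) + 2)

lemma term_eq_wallisRatio_sq (k : ℕ) : term k = wallisRatio k ^ 2 := rfl

lemma wallisRatio_nonneg (k : ℕ) : 0 ≤ wallisRatio k :=
  Finset.prod_nonneg fun j _ => by positivity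

lemma factorial_mul_wallisRatio (k : ℕ) :
    (k.factorial : ℝ) * wallisRatio k = (ascPochhammer ℝ k).eval (1 / 2) := by
  induction k with
  | zero => simp [wallisRatio]
  | succ k ih =>
    rw [ascPochhammer_succ_eval, ← ih, Nat.factorial_succ, wallisRatio, wallisRatio,
      Finset.prod_range_succ]
    push_cast
    field_simp
    ring

lemma choose_eq_wallisRatio (k : ℕ) : Ring.choose ((1 / 2 : ℝ) + k - 1) k = wallisRatio k := by
  rw [← Ring.multichoose_eq]
  have h := Ring.factorial_nsmul_multichoose_eq_ascPochhammer (1 / 2 : ℝ) k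
  rw [Polynomial.ascPochhammer_smeval_eq_eval, ← factorial_mul_wallisRatio, nsmul_eq_mul] at h
  exact mul_left_cancel₀ (by positivity) h

lemma hasSum_wallisRatio {z : ℝ} (hz : |z| < 1) :
    HasSum (fun k => wallisRatio k * z ^ k) (1 / √(1 - z)) := by
  have h := (Real.one_div_one_sub_rpow_hasFPowerSeriesOnBall_zero (1 / 2)).hasSum (y := z)
    (by simpa [enorm_eq_nnnorm, ← NNReal.coe_lt_coe] using hz)
  rw [zero_add] at h
  rw [← Real.sqrt_eq_rpow] at h
  refine h.congr_fun fun k => ?_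
  rw [FormalMultilinearSeries.ofScalars_apply_eq, choose_eq_wallisRatio, smul_eq_mul]

/-- Integrating the binomial series of (1 - x sin² θ)^{-1/2} term by term: the coefficient is one
Wallis ratio and ∫ sin^{2k} supplies the other, with the factor π. -/
lemma hasSum_pi_mul_term {x : ℝ} (h0 : 0 < x) (h1 : x < 1) :
    HasSum (fun k => Real.pi * term k * x ^ k)
      (∫ θ in (0 : ℝ)..Real.pi, 1 / √(1 - x * Real.sin θ ^ 2)) := by
  have hx : |x| < 1 := by rwa [abs_of_pos h0]
  have hle : ∀ θ : ℝ, |Real.sin θ ^ 2| ≤ 1 := fun θ => by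
    rw [abs_of_nonneg (sq_nonneg _)]; exact Real.sin_sq_le_one θ
  have h := intervalIntegral.hasSum_integral_of_dominated_convergence (a := 0) (b := Real.pi)
    (μ := volume) (F := fun (k : ℕ) θ => wallisRatio k * (x * Real.sin θ ^ 2) ^ k)
    (f := fun θ => 1 / √(1 - x * Real.sin θ ^ 2))
    (fun k _ => wallisRatio k * x ^ k)
    (fun k => by fun_prop)
    (fun k => Eventually.of_forall fun θ _ => by
      rw [mul_pow, norm_mul, norm_mul, Real.norm_of_nonneg (wallisRatio_nonneg k),
        Real.norm_of_nonneg (by positivity : 0 ≤ x ^ k), ← mul_assoc]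
      refine mul_le_of_le_one_right (mul_nonneg (wallisRatio_nonneg k) (by positivity)) ?_
      rw [norm_pow]
      exact pow_le_one₀ (norm_nonneg _) (hle θ))
    (Eventually.of_forall fun θ _ => (hasSum_wallisRatio hx).summable)
    intervalIntegrable_const
    (Eventually.of_forall fun θ _ => hasSum_wallisRatio (by
      rw [abs_mul]
      exact (mul_le_of_le_one_right (abs_nonneg _) (hle θ)).trans_lt hx))
  refine h.congr_fun fun k => ?_
  have hk : (fun θ : ℝ => wallisRatio k * (x * Real.sin θ ^ 2) ^ k)
      = fun θ => wallisRatio k * x ^ k * Real.sin θ ^ (2 * k) := by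
    ext θ
    rw [mul_pow, ← pow_mul, mul_assoc]
  rw [hk, intervalIntegral.integral_const_mul, integral_sin_pow_even, term_eq_wallisRatio_sq,
    wallisRatio]
  ring

/-! ### The complete elliptic integral near modulus 1 -/

lemma cos_pos_ellip {x : ℝ} (h0 : 0 < x) (h1 : x < 1) (θ : ℝ) : 0 < 1 - x * Real.cos θ ^ 2 := by
  nlinarith [Real.cos_sq_le_one θ, sq_nonneg (Real.cos θ)]

lemma integral_sin_ellip {x : ℝ} (h0 : 0 < x) (h1 : x < 1) :
    ∫ θ in (0 : ℝ)..Real.pi, 1 / √(1 - x * Real.sin θ ^ 2)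
      = 2 * ∫ θ in (0 : ℝ)..(Real.pi / 2), 1 / √(1 - x * Real.cos θ ^ 2) := by
  have hpos : ∀ θ : ℝ, 0 < 1 - x * Real.sin θ ^ 2 := fun θ => by
    nlinarith [Real.sin_sq_le_one θ, sq_nonneg (Real.sin θ)]
  have hc : Continuous fun θ : ℝ => 1 / √(1 - x * Real.sin θ ^ 2) :=
    continuous_const.div (by fun_prop) fun θ => (Real.sqrt_pos.2 (hpos θ)).ne'
  rw [← intervalIntegral.integral_add_adjacent_intervals (b := Real.pi / 2)
    (hc.intervalIntegrable _ _) (hc.intervalIntegrable _ _), two_mul]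
  congr 1
  · have h := intervalIntegral.integral_comp_sub_left (a := 0) (b := Real.pi / 2)
      (fun θ : ℝ => 1 / √(1 - x * Real.sin θ ^ 2)) (Real.pi / 2)
    simp only [sub_self, sub_zero, Real.sin_pi_div_two_sub] at h
    exact h.symm
  · have h := intervalIntegral.integral_comp_add_left (a := 0) (b := Real.pi / 2)
      (fun θ : ℝ => 1 / √(1 - x * Real.sin θ ^ 2)) (Real.pi / 2)
    simp only [add_halves, add_comm (Real.pi / 2), Real.sin_add_pi_div_two] at h
    rw [zero_add] at h
    exact h.symm

lemma integral_cos_div_ellip {x : ℝ} (h0 : 0 < x) (h1 : x < 1) :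
    ∫ θ in (0 : ℝ)..(Real.pi / 2), Real.cos θ / √(1 - x * Real.cos θ ^ 2)
      = (Real.log (1 + √x) - Real.log (1 - x) / 2) / √x := by
  have hx : 0 < 1 - x := by linarith
  have hsx := Real.sqrt_pos.2 h0
  have hs1 := Real.sqrt_pos.2 hx
  have hd : ∀ θ : ℝ, HasDerivAt (fun θ => Real.arsinh (√x * Real.sin θ / √(1 - x)) / √x)
      (Real.cos θ / √(1 - x * Real.cos θ ^ 2)) θ := fun θ => by
    have h := ((((Real.hasDerivAt_sin θ).const_mul √x).div_const √(1 - x)).arsinh).div_const √x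
    refine h.congr_deriv ?_
    have : 1 + (√x * Real.sin θ / √(1 - x)) ^ 2 = (1 - x * Real.cos θ ^ 2) / (1 - x) := by
      rw [div_pow, mul_pow, Real.sq_sqrt h0.le, Real.sq_sqrt hx.le, Real.sin_sq]
      field_simp
      ring
    rw [this, Real.sqrt_div' _ hx.le]
    have := Real.sqrt_pos.2 (cos_pos_ellip h0 h1 θ)
    simp only [smul_eq_mul]
    field_simp
  have hc : Continuous fun θ : ℝ => Real.cos θ / √(1 - x * Real.cos θ ^ 2) :=
    Real.continuous_cos.div (by fun_prop)
      fun θ => (Real.sqrt_pos.2 (cos_pos_ellip h0 h1 θ)).ne'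
  rw [intervalIntegral.integral_eq_sub_of_hasDerivAt (fun θ _ => hd θ) (hc.intervalIntegrable _ _)]
  simp only [Real.sin_pi_div_two, Real.sin_zero, mul_one, mul_zero, zero_div, Real.arsinh_zero,
    sub_zero]
  congr 1
  rw [Real.arsinh]
  have : 1 + (√x / √(1 - x)) ^ 2 = 1 / (1 - x) := by
    rw [div_pow, Real.sq_sqrt h0.le, Real.sq_sqrt hx.le]
    field_simp
    ring
  rw [this, Real.sqrt_div' _ hx.le, Real.sqrt_one, ← add_div, add_comm,
    Real.log_div (by positivity) hs1.ne', Real.log_sqrt hx.le]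

lemma integral_sin_div_one_add_cos :
    ∫ θ in (0 : ℝ)..(Real.pi / 2), Real.sin θ / (1 + Real.cos θ) = Real.log 2 := by
  have hpos : ∀ θ ∈ uIcc 0 (Real.pi / 2), 0 < 1 + Real.cos θ := fun θ hθ => by
    rw [uIcc_of_le (by positivity)] at hθ
    have := Real.cos_nonneg_of_mem_Icc (x := θ) ⟨by linarith [hθ.1, Real.pi_pos], hθ.2⟩
    linarith
  rw [intervalIntegral.integral_eq_sub_of_hasDerivAt (f := fun θ => -Real.log (1 + Real.cos θ))]
  · norm_num
  · intro θ hθ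
    have h := (((Real.hasDerivAt_cos θ).const_add 1).log (hpos θ hθ).ne').neg
    refine h.congr_deriv ?_
    ring
  · exact (ContinuousOn.div (by fun_prop) (by fun_prop) fun θ hθ => (hpos θ hθ).ne').intervalIntegrable

/-- Dominated convergence with bound 1: for c = cos θ in [0, 1], (1 - c)² ≤ 1 - c² ≤ 1 - xc². -/
lemma tendsto_integral_one_sub_cos_div :
    Tendsto (fun x : ℝ => ∫ θ in (0 : ℝ)..(Real.pi / 2),
      (1 - Real.cos θ) / √(1 - x * Real.cos θ ^ 2)) (𝓝[<] 1) (𝓝 (Real.log 2)) := by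
  rw [← integral_sin_div_one_add_cos]
  have hev : ∀ᶠ x : ℝ in 𝓝[<] 1, 0 < x ∧ x < 1 := by
    have := Ioo_mem_nhdsLT (show (0 : ℝ) < 1 by norm_num)
    exact this
  have hm : ∀ θ ∈ uIoc 0 (Real.pi / 2), 0 ≤ Real.cos θ ∧ 0 < Real.sin θ := fun θ hθ => by
    rw [uIoc_of_le (by positivity)] at hθ
    exact ⟨Real.cos_nonneg_of_mem_Icc (x := θ) ⟨by linarith [hθ.1, Real.pi_pos], hθ.2⟩,
      Real.sin_pos_of_pos_of_lt_pi hθ.1 (by linarith [hθ.2, Real.pi_pos])⟩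
  refine intervalIntegral.tendsto_integral_filter_of_dominated_convergence (fun _ => 1) ?_ ?_
    intervalIntegrable_const ?_
  · filter_upwards [hev] with x hx
    exact Continuous.aestronglyMeasurable (Continuous.div (by fun_prop) (by fun_prop)
      fun θ => (Real.sqrt_pos.2 (cos_pos_ellip hx.1 hx.2 θ)).ne')
  · filter_upwards [hev] with x hx
    refine Eventually.of_forall fun θ hθ => ?_
    obtain ⟨hc, hs⟩ := hm θ hθ
    have h1 := Real.cos_le_one θ
    rw [Real.norm_of_nonneg (div_nonneg (by linarith) (Real.sqrt_nonneg _)),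
      div_le_one (Real.sqrt_pos.2 (cos_pos_ellip hx.1 hx.2 θ))]
    apply Real.le_sqrt_of_sq_le
    nlinarith [sq_nonneg (Real.cos θ), mul_nonneg (sub_nonneg.2 hx.2.le) (sq_nonneg (Real.cos θ))]
  · refine Eventually.of_forall fun θ hθ => ?_
    obtain ⟨hc, hs⟩ := hm θ hθ
    have hlim : Real.sin θ / (1 + Real.cos θ) = (1 - Real.cos θ) / √(1 - 1 * Real.cos θ ^ 2) := by
      rw [one_mul, ← Real.sin_sq, Real.sqrt_sq hs.le, div_eq_div_iff (by linarith) hs.ne']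
      nlinarith [Real.sin_sq_add_cos_sq θ]
    rw [hlim]
    have hne : √(1 - 1 * Real.cos θ ^ 2) ≠ 0 := by
      rw [one_mul, ← Real.sin_sq, Real.sqrt_sq hs.le]; exact hs.ne'
    have : ContinuousAt (fun x : ℝ => (1 - Real.cos θ) / √(1 - x * Real.cos θ ^ 2)) 1 :=
      ContinuousAt.div (by fun_prop) (by fun_prop) hne
    exact this.tendsto.mono_left nhdsWithin_le_nhds

/-- Splitting the numerator as 1 = (1 - cos θ) + cos θ isolates the logarithmic singularity in an
elementary integral. Each part contributes 2 log 2. -/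
lemma tendsto_ellip_add_log :
    Tendsto (fun x : ℝ => (∫ θ in (0 : ℝ)..Real.pi, 1 / √(1 - x * Real.sin θ ^ 2))
      + Real.log (1 - x) / x) (𝓝[<] 1) (𝓝 (Real.log 16)) := by
  have hev : ∀ᶠ x : ℝ in 𝓝[<] 1, 0 < x ∧ x < 1 := by
    have := Ioo_mem_nhdsLT (show (0 : ℝ) < 1 by norm_num)
    exact this
  have h16 : Real.log 16 = 2 * Real.log 2 + (2 * Real.log (1 + √1) / √1
      + 0 / (1 * (1 + √1))) := by
    rw [show (16 : ℝ) = 2 ^ 4 by norm_num, Real.log_pow]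
    norm_num
    ring
  -- The logarithms leave log(1 - x) (1/x - 1/√x) = log(1 - x) (1 - x)/(x (1 + √x)), which vanishes
  -- in the limit.
  have hlog : Tendsto (fun x : ℝ => Real.log (1 - x) * (1 - x)) (𝓝[<] 1) (𝓝 0) := by
    have h : Tendsto (fun x : ℝ => Real.log x * x) (𝓝[>] 0) (𝓝 0) := by
      simpa using tendsto_log_mul_rpow_nhdsGT_zero one_pos
    refine h.comp (tendsto_nhdsWithin_iff.2 ⟨?_, ?_⟩)
    · have : ContinuousAt (fun x : ℝ => 1 - x) 1 := by fun_prop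
      simpa using this.tendsto.mono_left nhdsWithin_le_nhds
    · filter_upwards [hev] with x hx
      exact sub_pos.2 hx.2
  rw [h16]
  have hid : Tendsto (fun x : ℝ => x) (𝓝[<] 1) (𝓝 1) := tendsto_id.mono_left nhdsWithin_le_nhds
  have hsq : Tendsto (fun x : ℝ => √x) (𝓝[<] 1) (𝓝 √1) := hid.sqrt
  have hlim := (tendsto_integral_one_sub_cos_div.const_mul 2).add
    ((((hsq.const_add 1).log (by norm_num)).const_mul 2).div hsq (by norm_num) |>.add
      (hlog.div (hid.mul (hsq.const_add 1)) (by norm_num)))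
  refine hlim.congr' ?_
  filter_upwards [hev] with x hx
  obtain ⟨h0, h1⟩ := hx
  have hne : ∀ θ : ℝ, √(1 - x * Real.cos θ ^ 2) ≠ 0 := fun θ =>
    (Real.sqrt_pos.2 (cos_pos_ellip h0 h1 θ)).ne'
  have hsplit : ∫ θ in (0 : ℝ)..(Real.pi / 2), 1 / √(1 - x * Real.cos θ ^ 2)
      = (∫ θ in (0 : ℝ)..(Real.pi / 2), (1 - Real.cos θ) / √(1 - x * Real.cos θ ^ 2))
        + ∫ θ in (0 : ℝ)..(Real.pi / 2), Real.cos θ / √(1 - x * Real.cos θ ^ 2) := by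
    have hc : ∀ f : ℝ → ℝ, Continuous f → IntervalIntegrable
        (fun θ => f θ / √(1 - x * Real.cos θ ^ 2)) volume 0 (Real.pi / 2) := fun f hf =>
      (Continuous.div hf (by fun_prop) hne).intervalIntegrable _ _
    rw [← intervalIntegral.integral_add (hc (fun θ => 1 - Real.cos θ) (by fun_prop))
      (hc Real.cos (by fun_prop))]
    refine intervalIntegral.integral_congr fun θ _ => ?_
    ring
  rw [integral_sin_ellip h0 h1, hsplit, integral_cos_div_ellip h0 h1]
  obtain ⟨s, hs, rfl⟩ : ∃ s : ℝ, 0 < s ∧ x = s ^ 2 := ⟨√x, Real.sqrt_pos.2 h0, (Real.sq_sqrt h0.le).symm⟩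
  simp only [Pi.div_apply]
  rw [Real.sqrt_sq hs.le]
  have : (1 + s) ≠ 0 := by positivity
  field_simp
  ring_nf

lemma hasSum_pow_div {x : ℝ} (h0 : 0 < x) (h1 : x < 1) :
    HasSum (fun k : ℕ => 1 / ((k : ℝ) + 1) * x ^ k) (-Real.log (1 - x) / x) := by
  have h := (Real.hasSum_pow_div_log_of_abs_lt_one (x := x) (by rwa [abs_of_pos h0])).div_const x
  refine h.congr_fun fun k => ?_
  rw [pow_succ]
  field_simp

lemma exists_pi_mul_G_eq : ∃ c : ℝ, ∀ n : ℕ,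
    Real.pi * G n - Real.log ((n : ℝ) + 1) - tailInt ((n : ℝ) + 1) = c := by
  refine ⟨Real.pi * G 0 - Real.log (((0 : ℕ) : ℝ) + 1) - tailInt (((0 : ℕ) : ℝ) + 1), fun n => ?_⟩
  induction n with
  | zero => rfl
  | succ n ih =>
    rw [← ih]
    have hG : G (n + 1) = G n + term (n + 1) := Finset.sum_range_succ _ _
    have h1 := tailInt_sub_tailInt (x := (n : ℝ) + 1) (by positivity)
    have h2 := integral_exp_mul_leg_nat (n + 1)
    rw [Real.log_div (by positivity) (by positivity)] at h1
    push_cast at h2 ⊢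
    rw [hG, mul_add]
    linarith

lemma tendsto_natCast_add_one : Tendsto (fun n : ℕ => (n : ℝ) + 1) atTop atTop :=
  tendsto_atTop_add_const_right _ _ tendsto_natCast_atTop_atTop

/-- The error of the approximation `ln (16 N) + γ` to `π G_n`. -/
theorem pi_mul_G_eq (n : ℕ) : Real.pi * G n
    = Real.log (16 * ((n : ℝ) + 1)) + Real.eulerMascheroniConstant + tailInt ((n : ℝ) + 1) := by
  obtain ⟨c, hc⟩ := exists_pi_mul_G_eq
  -- Subtracting the harmonic series makes the sums converge, so that their limit can also be
  -- computed as an Abel limit.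
  have h1 : Tendsto (fun n : ℕ => ∑ i ∈ Finset.range (n + 1), (Real.pi * term i - 1 / ((i : ℝ) + 1)))
      atTop (𝓝 (c - Real.eulerMascheroniConstant)) := by
    have h := ((tendsto_tailInt.comp tendsto_natCast_add_one).const_add c).sub
      ((tendsto_add_atTop_iff_nat 1).2 Real.tendsto_harmonic_sub_log)
    rw [add_zero] at h
    refine h.congr fun n => ?_
    have hh : (harmonic (n + 1) : ℝ) = ∑ i ∈ Finset.range (n + 1), 1 / ((i : ℝ) + 1) := by
      simp [harmonic]
    have hG : Real.pi * G n = ∑ i ∈ Finset.range (n + 1), Real.pi * term i :=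
      Finset.mul_sum _ _ _
    rw [Finset.sum_sub_distrib, ← hh, ← hG]
    have := hc n
    simp only [Function.comp_apply]
    push_cast
    linarith
  -- Abel's limit theorem; the power series is the elliptic integral plus log(1 - x)/x.
  have h2 := Real.tendsto_tsum_powerSeries_nhdsWithin_lt ((tendsto_add_atTop_iff_nat 1).1 h1)
  have h3 : c - Real.eulerMascheroniConstant = Real.log 16 := by
    refine tendsto_nhds_unique h2 (tendsto_ellip_add_log.congr' ?_)
    filter_upwards [Ioo_mem_nhdsLT (show (0 : ℝ) < 1 by norm_num)] with x hx
    have h := ((hasSum_pi_mul_term hx.1 hx.2).sub (hasSum_pow_div hx.1 hx.2)).tsum_eq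
    simp only [← sub_mul] at h
    rw [h]
    ring
  rw [Real.log_mul (by norm_num) (by positivity), ← h3]
  linarith [hc n]


/-! ### The asymptotic expansion of `tailInt` -/

/-- The real part of `i ^ l * (sechAvg y + i * stepAvg y)`. -/
noncomputable def rotAvg : ℕ → ℝ → ℝ
  | 0, y => sechAvg y
  | 1, y => -stepAvg y
  | l + 2, y => -rotAvg l y

lemma rotAvg_add_two (l : ℕ) (y : ℝ) : rotAvg (l + 2) y = -rotAvg l y := by
  rw [rotAvg]

lemma rotAvg_four_mul_add (s r : ℕ) (y : ℝ) : rotAvg (4 * s + r) y = rotAvg r y := by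
  induction s with
  | zero => simp
  | succ s ih =>
    rw [show 4 * (s + 1) + r = 4 * s + r + 2 + 2 by ring, rotAvg_add_two, rotAvg_add_two, neg_neg, ih]

lemma continuous_rotAvg : ∀ l, Continuous (rotAvg l)
  | 0 => continuous_sechAvg
  | 1 => continuous_stepAvg.neg
  | l + 2 => (continuous_rotAvg l).neg

lemma integrableOn_pow_mul_rotAvg (k : ℕ) :
    ∀ l, IntegrableOn (fun y => y ^ k * rotAvg l y) (Ioi 0)
  | 0 => integrableOn_pow_mul_sechAvg k
  | 1 => by
    refine (integrableOn_pow_mul_stepAvg k).neg.congr_fun (fun y _ => ?_) measurableSet_Ioi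
    simp [rotAvg]
  | l + 2 => by
    refine (integrableOn_pow_mul_rotAvg k l).neg.congr_fun (fun y _ => ?_) measurableSet_Ioi
    simp [rotAvg]

/-- The coefficients of the asymptotic expansion; the entry at `0` is not used. -/
noncomputable def coeff : ℕ → ℝ
  | 0 => 0
  | l + 1 => -2 * ∫ y in Ioi (0 : ℝ), y ^ l * rotAvg l y

/-- The integrand of the remainder after `l` terms. -/
noncomputable def remKer (l : ℕ) (x y : ℝ) : ℝ :=
  y ^ l * (x * rotAvg l y + y * rotAvg (l + 1) y) / (x ^ 2 + y ^ 2)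

/-- The remainder of the expansion of `tailInt` after `l` terms. -/
noncomputable def remainder (l : ℕ) (x : ℝ) : ℝ :=
  -2 / x ^ l * ∫ y in Ioi (0 : ℝ), remKer l x y

lemma norm_remKer_le (l : ℕ) {x y : ℝ} (hx : 1 ≤ x) (hy : 0 < y) :
    ‖remKer l x y‖ ≤ (‖y ^ l * rotAvg l y‖ + ‖y ^ (l + 1) * rotAvg (l + 1) y‖) / x := by
  have hx0 : 0 < x := by linarith
  rw [remKer, norm_div, Real.norm_of_nonneg (by positivity : 0 ≤ x ^ 2 + y ^ 2),
    div_le_div_iff₀ (by positivity) hx0]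
  have h : ‖y ^ l * (x * rotAvg l y + y * rotAvg (l + 1) y)‖
      ≤ x * ‖y ^ l * rotAvg l y‖ + ‖y ^ (l + 1) * rotAvg (l + 1) y‖ := by
    rw [show y ^ l * (x * rotAvg l y + y * rotAvg (l + 1) y)
      = x * (y ^ l * rotAvg l y) + y ^ (l + 1) * rotAvg (l + 1) y by ring]
    refine (norm_add_le _ _).trans ?_
    rw [norm_mul, Real.norm_of_nonneg hx0.le]
  have ha := norm_nonneg (y ^ l * rotAvg l y)
  have hb := norm_nonneg (y ^ (l + 1) * rotAvg (l + 1) y)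
  generalize ‖y ^ l * rotAvg l y‖ = a at *
  generalize ‖y ^ (l + 1) * rotAvg (l + 1) y‖ = b at *
  nlinarith [mul_le_mul_of_nonneg_right h hx0.le, mul_nonneg ha (sq_nonneg y),
    mul_nonneg hb (sq_nonneg y), mul_nonneg hb (mul_nonneg hx0.le (sub_nonneg.2 hx))]

lemma integrableOn_norm_rotAvg (l : ℕ) : IntegrableOn
    (fun y => ‖y ^ l * rotAvg l y‖ + ‖y ^ (l + 1) * rotAvg (l + 1) y‖) (Ioi 0) :=
  (integrableOn_pow_mul_rotAvg l l).norm.add (integrableOn_pow_mul_rotAvg (l + 1) (l + 1)).norm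

lemma integrableOn_remKer (l : ℕ) {x : ℝ} (hx : 1 ≤ x) : IntegrableOn (remKer l x) (Ioi 0) := by
  refine ((integrableOn_norm_rotAvg l).div_const x).mono' (Continuous.aestronglyMeasurable ?_)
    ((ae_restrict_iff' measurableSet_Ioi).2 (Eventually.of_forall fun y hy => norm_remKer_le l hx hy))
  have h1 := continuous_rotAvg l
  have h2 := continuous_rotAvg (l + 1)
  have : ∀ y : ℝ, x ^ 2 + y ^ 2 ≠ 0 := fun y => by positivity
  unfold remKer
  fun_prop (disch := assumption)

lemma exists_norm_remainder_le (l : ℕ) :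
    ∃ C, ∀ x : ℝ, 1 ≤ x → ‖remainder l x‖ ≤ C * ‖1 / x ^ (l + 1)‖ := by
  refine ⟨2 * ∫ y in Ioi (0 : ℝ), (‖y ^ l * rotAvg l y‖ + ‖y ^ (l + 1) * rotAvg (l + 1) y‖),
    fun x hx => ?_⟩
  have hx0 : 0 < x := by linarith
  have h := norm_integral_le_of_norm_le ((integrableOn_norm_rotAvg l).div_const x)
    ((ae_restrict_iff' measurableSet_Ioi).2 (Eventually.of_forall fun y hy => norm_remKer_le l hx hy))
  rw [integral_div] at h
  rw [remainder, norm_mul, norm_div, norm_neg, Real.norm_ofNat,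
    Real.norm_of_nonneg (by positivity : 0 ≤ x ^ l),
    Real.norm_of_nonneg (by positivity : 0 ≤ 1 / x ^ (l + 1))]
  refine (mul_le_mul_of_nonneg_left h (by positivity)).trans_eq ?_
  field_simp
  ring

lemma remainder_zero (x : ℝ) : remainder 0 x = tailInt x := by
  simp [remainder, tailInt, remKer, rotAvg, sub_eq_add_neg]

/-- One step of the geometric expansion: iy/(x - iy) = x/(x - iy) - 1. -/
lemma remainder_succ (l : ℕ) {x : ℝ} (hx : 1 ≤ x) :
    remainder (l + 1) x = remainder l x - coeff (l + 1) / x ^ (l + 1) := by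
  have hx0 : 0 < x := by linarith
  have h : ∫ y in Ioi (0 : ℝ), remKer (l + 1) x y
      = x * (∫ y in Ioi (0 : ℝ), remKer l x y) - ∫ y in Ioi (0 : ℝ), y ^ l * rotAvg l y := by
    rw [← integral_const_mul, ← integral_sub ((integrableOn_remKer l hx).const_mul x)
      (integrableOn_pow_mul_rotAvg l l)]
    congr 1 with y
    have : x ^ 2 + y ^ 2 ≠ 0 := by positivity
    rw [remKer, remKer, rotAvg_add_two]
    field_simp
    ring
  rw [remainder, h, remainder, coeff]
  field_simp
  ring

lemma tailInt_eq_sum_add_remainder (l : ℕ) {x : ℝ} (hx : 1 ≤ x) :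
    tailInt x = ∑ k ∈ Finset.Icc 1 l, coeff k / x ^ k + remainder l x := by
  induction l with
  | zero => simp [remainder_zero]
  | succ l ih =>
    rw [Finset.sum_Icc_succ_top (by omega), remainder_succ l hx, ih]
    ring

/-! ### Signs of the remainders and coefficients -/

lemma setIntegral_Ioi_pos {f : ℝ → ℝ} (hf : IntegrableOn f (Ioi 0)) (h : ∀ y, 0 < y → 0 < f y) :
    0 < ∫ y in Ioi (0 : ℝ), f y := by
  rw [setIntegral_pos_iff_support_of_nonneg_ae
    ((ae_restrict_iff' measurableSet_Ioi).2 (Eventually.of_forall fun y hy => (h y hy).le)) hf]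
  have : Function.support f ∩ Ioi 0 = Ioi 0 :=
    inter_eq_right.2 fun y hy => (h y hy).ne'
  simp [this]

lemma remainder_pos_and_coeff_pos {l : ℕ} (h0 : ∀ y, rotAvg l y < 0)
    (h1 : ∀ x y : ℝ, 1 ≤ x → 0 < y → x * rotAvg l y + y * rotAvg (l + 1) y < 0) :
    (∀ x, 1 ≤ x → 0 < remainder l x) ∧ 0 < coeff (l + 1) := by
  constructor
  · intro x hx
    have hx0 : 0 < x := by linarith
    have h := setIntegral_Ioi_pos (integrableOn_remKer l hx).neg fun y hy => by
      rw [Pi.neg_apply, neg_pos, remKer]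
      exact div_neg_of_neg_of_pos (mul_neg_of_pos_of_neg (by positivity) (h1 x y hx hy))
        (by positivity)
    simp only [Pi.neg_apply, integral_neg, neg_pos] at h
    exact mul_pos_of_neg_of_neg (div_neg_of_neg_of_pos (by norm_num) (by positivity)) h
  · have h := setIntegral_Ioi_pos (integrableOn_pow_mul_rotAvg l l).neg fun y hy => by
      rw [Pi.neg_apply, neg_pos]
      exact mul_neg_of_pos_of_neg (by positivity) (h0 y)
    simp only [Pi.neg_apply, integral_neg, neg_pos] at h
    exact mul_pos_of_neg_of_neg (by norm_num) h

lemma remainder_neg_and_coeff_neg {l : ℕ} (h0 : ∀ y, 0 < rotAvg l y)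
    (h1 : ∀ x y : ℝ, 1 ≤ x → 0 < y → 0 < x * rotAvg l y + y * rotAvg (l + 1) y) :
    (∀ x, 1 ≤ x → remainder l x < 0) ∧ coeff (l + 1) < 0 := by
  constructor
  · intro x hx
    have hx0 : 0 < x := by linarith
    have h := setIntegral_Ioi_pos (integrableOn_remKer l hx) fun y hy => by
      have := h1 x y hx hy
      rw [remKer]
      positivity
    exact mul_neg_of_neg_of_pos (div_neg_of_neg_of_pos (by norm_num) (by positivity)) h
  · have h := setIntegral_Ioi_pos (integrableOn_pow_mul_rotAvg l l) fun y hy => by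
      have := h0 y
      positivity
    exact mul_neg_of_neg_of_pos (by norm_num) h

/-- The bracket in `remKer` is -(xS + yV) for p ≡ 1 and -(xV - yS) for p ≡ 2 mod 4. The second needs
y S < V and x ≥ 1. -/
lemma lower_remainder {p : ℕ} (hp : ∃ s : ℕ, p = 4 * s + 1 ∨ p = 4 * s + 2) :
    (∀ x, 1 ≤ x → 0 < remainder p x) ∧ 0 < coeff (p + 1) := by
  obtain ⟨s, rfl | rfl⟩ := hp
  · refine remainder_pos_and_coeff_pos (fun y => ?_) fun x y hx hy => ?_
    · rw [rotAvg_four_mul_add]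
      simpa [rotAvg] using stepAvg_pos y
    · rw [add_assoc, rotAvg_four_mul_add, rotAvg_four_mul_add]
      simp only [rotAvg]
      nlinarith [mul_pos hy (sechAvg_pos y), mul_pos (show 0 < x by linarith) (stepAvg_pos y)]
  · refine remainder_pos_and_coeff_pos (fun y => ?_) fun x y hx hy => ?_
    · rw [rotAvg_four_mul_add]
      simpa [rotAvg] using sechAvg_pos y
    · rw [add_assoc, rotAvg_four_mul_add, rotAvg_four_mul_add]
      simp only [rotAvg]
      nlinarith [mul_stepAvg_lt_sechAvg y, mul_nonneg (sub_nonneg.2 hx) (sechAvg_pos y).le]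

/-- The bracket in `remKer` is xV - yS for q ≡ 0 and xS + yV for q ≡ 3 mod 4. -/
lemma upper_remainder {q : ℕ} (hq : ∃ m : ℕ, q = 4 * m ∨ q = 4 * m + 3) :
    (∀ x, 1 ≤ x → remainder q x < 0) ∧ coeff (q + 1) < 0 := by
  obtain ⟨m, rfl | rfl⟩ := hq
  · refine remainder_neg_and_coeff_neg (fun y => ?_) fun x y hx hy => ?_
    · rw [← add_zero (4 * m), rotAvg_four_mul_add]
      simpa [rotAvg] using sechAvg_pos y
    · rw [rotAvg_four_mul_add, ← add_zero (4 * m), rotAvg_four_mul_add]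
      simp only [rotAvg]
      nlinarith [mul_stepAvg_lt_sechAvg y, mul_nonneg (sub_nonneg.2 hx) (sechAvg_pos y).le]
  · refine remainder_neg_and_coeff_neg (fun y => ?_) fun x y hx hy => ?_
    · rw [rotAvg_four_mul_add]
      simpa [rotAvg] using stepAvg_pos y
    · rw [add_assoc, rotAvg_four_mul_add, rotAvg_four_mul_add]
      simp only [rotAvg]
      nlinarith [mul_pos hy (sechAvg_pos y), mul_pos (show 0 < x by linarith) (stepAvg_pos y)]

/-! ### The expansion of the Landau constants -/

lemma pi_mul_G_sub_A (l n : ℕ) :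
    Real.pi * G n - A coeff l ((n : ℝ) + 1) = remainder l ((n : ℝ) + 1) := by
  rw [pi_mul_G_eq, A, tailInt_eq_sum_add_remainder l (by simp)]
  ring

lemma isLittleO_one_div_pow {k l : ℕ} (h : k < l) :
    (fun n : ℕ => 1 / ((n : ℝ) + 1) ^ l) =o[atTop] fun n : ℕ => 1 / ((n : ℝ) + 1) ^ k := by
  rw [isLittleO_iff_tendsto' (Eventually.of_forall fun n hn => absurd hn (by positivity))]
  have h1 : Tendsto (fun n : ℕ => 1 / ((n : ℝ) + 1) ^ (l - k)) atTop (𝓝 0) :=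
    tendsto_const_nhds.div_atTop
      ((tendsto_pow_atTop (by omega)).comp tendsto_natCast_add_one)
  refine h1.congr fun n => ?_
  obtain ⟨m, rfl⟩ := Nat.exists_eq_add_of_lt h
  rw [show k + m + 1 - k = m + 1 by omega, show k + m + 1 = k + (m + 1) by omega, pow_add]
  field_simp
  ring

lemma isLittleO_remainder (l : ℕ) : (fun n : ℕ => remainder l ((n : ℝ) + 1))
    =o[atTop] fun n : ℕ => 1 / ((n : ℝ) + 1) ^ l := by
  obtain ⟨C, hC⟩ := exists_norm_remainder_le l
  exact (IsBigO.of_bound C (Eventually.of_forall fun n => hC _ (by simp))).trans_isLittleO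
    (isLittleO_one_div_pow l.lt_succ_self)

lemma isExpansion_coeff : IsExpansion coeff := fun l => by
  simpa only [pi_mul_G_sub_A] using isLittleO_remainder l

/-! ### Uniqueness of the coefficients and optimality of the bounds -/

lemma eq_zero_of_isLittleO_one_div_pow {c : ℝ} {l : ℕ}
    (h : (fun n : ℕ => c / ((n : ℝ) + 1) ^ l) =o[atTop] fun n : ℕ => 1 / ((n : ℝ) + 1) ^ l) :
    c = 0 := by
  rw [isLittleO_iff_tendsto' (Eventually.of_forall fun n hn => absurd hn (by positivity))] at h
  refine tendsto_nhds_unique (h.congr fun n => ?_) tendsto_const_nhds |>.symm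
  field_simp

/-- Once the earlier coefficients agree, the two truncations differ by the single last term, which
must be of smaller order than its own power of 1/N. -/
lemma IsExpansion.unique {α β : ℕ → ℝ} (hα : IsExpansion α) (hβ : IsExpansion β) {k : ℕ}
    (hk : 1 ≤ k) : α k = β k := by
  induction k using Nat.strong_induction_on with
  | _ k ih =>
    obtain ⟨l, rfl⟩ := Nat.exists_eq_add_of_le' hk
    have hsum : ∀ x : ℝ, ∑ k ∈ Finset.Icc 1 l, α k / x ^ k = ∑ k ∈ Finset.Icc 1 l, β k / x ^ k :=
      fun x => Finset.sum_congr rfl fun i hi => by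
        rw [Finset.mem_Icc] at hi
        rw [ih i (by omega) hi.1]
    have h := (hβ (l + 1)).sub (hα (l + 1))
    refine sub_eq_zero.1 (eq_zero_of_isLittleO_one_div_pow (l := l + 1) (h.congr_left fun n => ?_))
    simp only [A, Finset.sum_Icc_succ_top (show 1 ≤ l + 1 by omega), hsum]
    ring

lemma IsExpansion.A_eq {α : ℕ → ℝ} (hα : IsExpansion α) (l : ℕ) (x : ℝ) :
    A α l x = A coeff l x := by
  rw [A, A, Finset.sum_congr rfl fun k hk => ?_]
  rw [hα.unique isExpansion_coeff (Finset.mem_Icc.1 hk).1]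

/-- The remainder minus its leading term is the next remainder, which is of smaller order. -/
lemma isEquivalent_remainder {l : ℕ} (h : coeff (l + 1) ≠ 0) :
    (fun n : ℕ => remainder l ((n : ℝ) + 1))
      ~[atTop] fun n : ℕ => coeff (l + 1) / ((n : ℝ) + 1) ^ (l + 1) := by
  have h1 := (isLittleO_remainder (l + 1)).const_mul_right h
  refine h1.congr (fun n => ?_) fun n => ?_
  · simp [remainder_succ l (show (1 : ℝ) ≤ (n : ℝ) + 1 by simp)]
  · ring

lemma tendsto_pow_mul_sum {d : ℕ → ℝ} {k p : ℕ} (hk : k ≤ p) (hd : ∀ i < k, d i = 0) :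
    Tendsto (fun n : ℕ => ((n : ℝ) + 1) ^ k * ∑ i ∈ Finset.range (p + 1), d i / ((n : ℝ) + 1) ^ i)
      atTop (𝓝 (d k)) := by
  simp_rw [Finset.mul_sum]
  have h : d k = ∑ i ∈ Finset.range (p + 1), if i = k then d k else 0 := by
    rw [Finset.sum_ite_eq' _ k, if_pos (Finset.mem_range.2 (by omega))]
  rw [h]
  refine tendsto_finsetSum _ fun i _ => ?_
  rcases lt_trichotomy i k with hik | rfl | hik
  · simp [hd i hik, hik.ne]
  · rw [if_pos rfl]
    refine tendsto_const_nhds.congr fun n => ?_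
    field_simp
  · rw [if_neg hik.ne']
    have h1 := ((isLittleO_one_div_pow hik).tendsto_div_nhds_zero).const_mul (d i)
    rw [mul_zero] at h1
    refine h1.congr fun n => ?_
    field_simp

/-- Let d_k be the first nonzero coefficient. Multiplied by N^k the sum tends to d_k, while r tends
to 0 because k ≤ p; so d_k < 0 and the sum is eventually negative. If no coefficient up to p is
nonzero, the sum vanishes. -/
lemma eventually_sum_nonpos {d r : ℕ → ℝ} {p : ℕ}
    (hr : r =o[atTop] fun n : ℕ => 1 / ((n : ℝ) + 1) ^ p)
    (h : ∀ᶠ n : ℕ in atTop, ∑ i ∈ Finset.range (p + 1), d i / ((n : ℝ) + 1) ^ i ≤ r n) :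
    ∀ᶠ n : ℕ in atTop, ∑ i ∈ Finset.range (p + 1), d i / ((n : ℝ) + 1) ^ i ≤ 0 := by
  by_cases h0 : ∃ k, k ≤ p ∧ d k ≠ 0
  · classical
    obtain ⟨hk, hdk⟩ := Nat.find_spec h0
    set k := Nat.find h0
    have hd : ∀ i < k, d i = 0 := fun i hi => by
      by_contra hne
      exact Nat.find_min h0 hi ⟨by omega, hne⟩
    have hlim := tendsto_pow_mul_sum hk hd
    have hrk : Tendsto (fun n : ℕ => ((n : ℝ) + 1) ^ k * r n) atTop (𝓝 0) := by
      have hO : (fun n : ℕ => 1 / ((n : ℝ) + 1) ^ p) =O[atTop] fun n : ℕ => 1 / ((n : ℝ) + 1) ^ k := by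
        rcases hk.eq_or_lt with he | hlt
        · rw [he]
        · exact (isLittleO_one_div_pow hlt).isBigO
      refine (hr.trans_isBigO hO).tendsto_div_nhds_zero.congr fun n => ?_
      field_simp
    have hle : d k ≤ 0 := le_of_tendsto_of_tendsto hlim hrk <| h.mono fun n hn =>
      mul_le_mul_of_nonneg_left hn (by positivity)
    filter_upwards [hlim.eventually_lt_const (hle.lt_of_ne hdk)] with n hn
    exact (neg_of_mul_neg_right hn (by positivity)).le
  · push Not at h0
    refine Eventually.of_forall fun n => (Finset.sum_eq_zero fun i hi => ?_).le
    rw [h0 i (by simpa [Nat.lt_succ_iff] using hi), zero_div]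

/-- The coefficients of `trial c l x - A α l x` in powers of `1 / x`. -/
noncomputable def diffCoeff (c α : ℕ → ℝ) : ℕ → ℝ
  | 0 => c 0 - Real.eulerMascheroniConstant
  | k + 1 => c (k + 1) - α (k + 1)

lemma trial_sub_A (c α : ℕ → ℝ) (l : ℕ) (x : ℝ) :
    trial c l x - A α l x = ∑ i ∈ Finset.range (l + 1), diffCoeff c α i / x ^ i := by
  induction l with
  | zero => simp [trial, A, diffCoeff]
  | succ l ih =>
    rw [Finset.sum_range_succ, ← ih, trial, trial, A, A, Finset.sum_range_succ _ (l + 1),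
      Finset.sum_Icc_succ_top (by omega), diffCoeff]
    ring

lemma IsExpansion.eventually_trial_le {α : ℕ → ℝ} (hα : IsExpansion α) {p : ℕ} {c : ℕ → ℝ}
    (h : ∀ᶠ n : ℕ in atTop, trial c p ((n : ℝ) + 1) ≤ Real.pi * G n) :
    ∀ᶠ n : ℕ in atTop, trial c p ((n : ℝ) + 1) ≤ A α p ((n : ℝ) + 1) := by
  have := eventually_sum_nonpos (d := diffCoeff c α) (hα p) (h.mono fun n hn => by
    rw [← trial_sub_A]
    linarith)
  filter_upwards [this] with n hn
  rw [← trial_sub_A] at hn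
  linarith

lemma IsExpansion.eventually_le_trial {α : ℕ → ℝ} (hα : IsExpansion α) {q : ℕ} {c : ℕ → ℝ}
    (h : ∀ᶠ n : ℕ in atTop, Real.pi * G n ≤ trial c q ((n : ℝ) + 1)) :
    ∀ᶠ n : ℕ in atTop, A α q ((n : ℝ) + 1) ≤ trial c q ((n : ℝ) + 1) := by
  have hneg : ∀ n : ℕ, ∑ i ∈ Finset.range (q + 1), -diffCoeff c α i / ((n : ℝ) + 1) ^ i
      = A α q ((n : ℝ) + 1) - trial c q ((n : ℝ) + 1) := fun n => by
    rw [← neg_sub, trial_sub_A, ← Finset.sum_neg_distrib]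
    simp only [neg_div]
  have := eventually_sum_nonpos (d := fun i => -diffCoeff c α i) (hα q).neg_left
    (h.mono fun n hn => by
      rw [hneg]
      linarith)
  filter_upwards [this] with n hn
  rw [hneg] at hn
  linarith

end Landau

theorem corollary1 :
    -- the asymptotic expansion exists
    (∃ α : ℕ → ℝ, Landau.IsExpansion α) ∧
    -- and its coefficients have the following properties
    ∀ α : ℕ → ℝ, Landau.IsExpansion α →
      ∀ p q : ℕ, (∃ s : ℕ, p = 4 * s + 1 ∨ p = 4 * s + 2) →
        (∃ m : ℕ, q = 4 * m ∨ q = 4 * m + 3) →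
        -- the bounds, for all `n ≥ 0`
        (∀ n : ℕ, Landau.A α p ((n : ℝ) + 1) < Real.pi * Landau.G n ∧
          Real.pi * Landau.G n < Landau.A α q ((n : ℝ) + 1)) ∧
        -- optimality as `n → ∞`: the errors have exact order `N^{-(p+1)}` and `N^{-(q+1)}`
        (0 < α (p + 1) ∧
          (fun n : ℕ => Real.pi * Landau.G n - Landau.A α p ((n : ℝ) + 1))
            ~[atTop] fun n : ℕ => α (p + 1) / ((n : ℝ) + 1) ^ (p + 1)) ∧
        (α (q + 1) < 0 ∧
          (fun n : ℕ => Real.pi * Landau.G n - Landau.A α q ((n : ℝ) + 1))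
            ~[atTop] fun n : ℕ => α (q + 1) / ((n : ℝ) + 1) ^ (q + 1)) ∧
        -- and no bound of the same form is better for large `n`
        (∀ c : ℕ → ℝ,
          (∀ᶠ n : ℕ in atTop, Landau.trial c p ((n : ℝ) + 1) ≤ Real.pi * Landau.G n) →
          ∀ᶠ n : ℕ in atTop, Landau.trial c p ((n : ℝ) + 1) ≤ Landau.A α p ((n : ℝ) + 1)) ∧
        (∀ c : ℕ → ℝ,
          (∀ᶠ n : ℕ in atTop, Real.pi * Landau.G n ≤ Landau.trial c q ((n : ℝ) + 1)) →
          ∀ᶠ n : ℕ in atTop, Landau.A α q ((n : ℝ) + 1) ≤ Landau.trial c q ((n : ℝ) + 1)) := by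
  refine ⟨⟨_, Landau.isExpansion_coeff⟩, fun α hα p q hp hq => ?_⟩
  obtain ⟨hp1, hp2⟩ := Landau.lower_remainder hp
  obtain ⟨hq1, hq2⟩ := Landau.upper_remainder hq
  have hcoeff : ∀ k : ℕ, α (k + 1) = Landau.coeff (k + 1) := fun k =>
    hα.unique Landau.isExpansion_coeff (by omega)
  refine ⟨fun n => ⟨?_, ?_⟩, ⟨?_, ?_⟩, ⟨?_, ?_⟩, fun c hc => hα.eventually_trial_le hc,
    fun c hc => hα.eventually_le_trial hc⟩
  · rw [hα.A_eq, ← sub_pos, Landau.pi_mul_G_sub_A]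
    exact hp1 _ (by simp)
  · rw [hα.A_eq, ← sub_neg, Landau.pi_mul_G_sub_A]
    exact hq1 _ (by simp)
  · rwa [hcoeff]
  · simp only [hα.A_eq, Landau.pi_mul_G_sub_A, hcoeff]
    exact Landau.isEquivalent_remainder hp2.ne'
  · rwa [hcoeff]
  · simp only [hα.A_eq, Landau.pi_mul_G_sub_A, hcoeff]
    exact Landau.isEquivalent_remainder hq2.ne
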